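/- Let $n,p\in\mathbb N$, let $f:\mathbb R\to\mathbb R$ be measurable, and for $g\sim\mathcal N(0,1)$ put $\mu=\mathbb E[f(g)g]$, $\sigma=\sqrt{\mathbb E[(f(g)-\mu g)^2]}$, $\gamma=\sqrt{\mathbb E[g^2(f(g)-\mu g)^2]}$, where $f(g)$ and $g f(g)$ are assumed square integrable, so that these are finite. Let $b_n=\mathbb E\|\mathbf g\|$ for $\mathbf g\sim\mathcal N(0,I_n)$ and, with $f$ acting entrywise, for $\eta\ge 0$ let $$p(\eta)=\mathbb P\big(\|f(\mathbf g)-\mu\mathbf g\|>\eta b_n\sigma\big)+\mathbb P\Big(|\mathbf g^T(f(\mathbf g)-\mu\mathbf g)|>\eta\tfrac{b_n^2}{\sqrt n}\gamma\Big).$$ All norms are Euclidean. Let $\theta^*\in\mathbb R^p$ with $\|\theta^*\|=1$, let $\mathcal R:\mathbb R^p\to\mathbb R$ be convex with subdifferential $\partial\mathcal R$, and let $\lambda\ge 0$ and $0\le t\le b_n$. Put $\mathcal G(\lambda)=\sqrt{\mathbb E[\mathrm{dist}^2(\mathbf h,\lambda\,\partial\mathcal R(\mu\theta^*))]}$ with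 $\mathbf h\sim\mathcal N(0,I_p)$, and $n_0(\lambda)=\phi^{-1}(\mathcal G(\lambda)+7t+\sqrt2)$, where $\phi(s)=\sqrt2\,\Gamma(\frac{s+1}2)/\Gamma(\frac s2)$ on $(0,\infty)$. Assume $n>n_0(\lambda)$. Let $X_0,X_1,X_2,\dots$ be independent random $n\times p$ matrices with i.i.d. $\mathcal N(0,1)$ entries, and $y_\tau=f(X_\tau\theta^*)$. Let $\theta_0\in\mathbb R^p$ be a (deterministic) initial estimate and let $M_0,\rho\in\mathbb R$ satisfy $M_0\ge\|\theta_0-\mu\theta^*\|$ and $\rho\ge\sqrt{n_0(\lambda)/n}$. For $\tau\ge 0$ define $$M_{\tau+1}=\rho M_\tau+\frac{\eta(\sigma\sqrt{n_0(\lambda)}+\gamma)}{\sqrt n},\qquad \lambda_\tau=\frac{\big((1+\frac t{b_n})M_\tau+\eta\sigma\big)\lambda}{b_n},$$ $$\theta_{\tau+1}=\mathrm{prox}_{\lambda_\tau}\Big(\theta_\tau+\tfrac1{b_n^2}X_\tau^T(y_\tau-X_\tau\theta_\tau)\Big),\qquad \mathrm{prox}_{s}(z)=\arg\min_{u\in\mathbb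 R^p}\tfrac12\|z-u\|^2+s\,\mathcal R(u).$$ Then for every $\tau\in\{0,1,2,\dots\}$, with probability at least $1-\tau\,(2p(\eta)+7e^{-t^2/2})$, one has $\|\theta_k-\mu\theta^*\|\le M_k$ for all $0\le k\le\tau$ (in particular $\|\theta_\tau-\mu\theta^*\|\le M_\tau$). -/

import Mathlib

open MeasureTheory ProbabilityTheory
open scoped Matrix Pointwise

noncomputable section

namespace ProxGD

/-- Euclidean space `ℝ^d`. -/
abbrev E (d : ℕ) : Type := EuclideanSpace ℝ (Fin d)

/-! ### Nonlinearity parameters of the link function -/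

/-- Mean term `μ = 𝔼[f(g) g]`, with `g` a standard normal variable. -/
def meanTerm (f : ℝ → ℝ) : ℝ := ∫ g, f g * g ∂(gaussianReal 0 1)

/-- `σ`, the nonnegative root of the variance term `σ² = 𝔼[(f(g) - μ g)²]`. -/
def sigmaTerm (f : ℝ → ℝ) : ℝ :=
  √(∫ g, (f g - meanTerm f * g) ^ 2 ∂(gaussianReal 0 1))

/-- `γ`, the nonnegative root of the deviation term `γ² = 𝔼[g² (f(g) - μ g)²]`. -/
def gammaTerm (f : ℝ → ℝ) : ℝ :=
  √(∫ g, g ^ 2 * (f g - meanTerm f * g) ^ 2 ∂(gaussianReal 0 1))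

/-- `b_n = 𝔼 ‖g‖` for `g ∼ N(0, I_n)`. -/
def gaussNorm (n : ℕ) : ℝ := ∫ g, ‖g‖ ∂(stdGaussian (E n))

/-- The vector `f(g) - μ g`, with `f` acting entrywise. -/
def effNoise {n : ℕ} (f : ℝ → ℝ) (g : E n) : E n :=
  WithLp.toLp 2 fun i => f (g i) - meanTerm f * g i

/-- Concentration probability function
`p(η) = ℙ(‖f(g) - μ g‖ > η b_n σ) + ℙ(|gᵀ(f(g) - μ g)| > η (b_n² / √n) γ)`, `g ∼ N(0, I_n)`. -/
def concProb (n : ℕ) (f : ℝ → ℝ) (η : ℝ) : ℝ :=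
  (stdGaussian (E n)).real {g | η * gaussNorm n * sigmaTerm f < ‖effNoise f g‖} +
  (stdGaussian (E n)).real
    {g | η * (gaussNorm n ^ 2 / √(n : ℝ)) * gammaTerm f < |inner ℝ g (effNoise f g)|}

/-! ### Sample complexity of the regularizer -/

/-- Subdifferential of a function `R : ℝ^d → ℝ` at `x`. -/
def subdiff {d : ℕ} (R : E d → ℝ) (x : E d) : Set (E d) :=
  {v | ∀ y, R x + inner ℝ v (y - x) ≤ R y}

/-- Gaussian distance `√(𝔼[dist²(g, l ∂R(x))])`, `g ∼ N(0, I_d)`. -/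
def gaussDist {d : ℕ} (R : E d → ℝ) (x : E d) (l : ℝ) : ℝ :=
  √(∫ g, Metric.infDist g (l • subdiff R x) ^ 2 ∂(stdGaussian (E d)))

/-- `φ(s) = √2 Γ((s+1)/2) / Γ(s/2)`. -/
def phi (s : ℝ) : ℝ := √2 * Real.Gamma ((s + 1) / 2) / Real.Gamma (s / 2)

/-- Minimal sample function `φ⁻¹(𝒢(l) + 7 t + √2)`, where `φ⁻¹` is the inverse of the
increasing bijection `φ : (0, ∞) → (0, ∞)`. -/
def minSamples {d : ℕ} (R : E d → ℝ) (x : E d) (l t : ℝ) : ℝ :=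
  Function.invFunOn phi (Set.Ioi 0) (gaussDist R x l + 7 * t + √2)

/-! ### The resampled proximal gradient method -/

/-- `w` minimizes `u ↦ ‖z - u‖² / 2 + l R(u)`. -/
def IsProx {d : ℕ} (R : E d → ℝ) (l : ℝ) (z w : E d) : Prop :=
  IsMinOn (fun u => 1 / 2 * ‖z - u‖ ^ 2 + l * R u) Set.univ w

/-- Proximal map: the minimizer of `u ↦ ‖z - u‖² / 2 + l R(u)`, which exists and is unique when
`R` is convex and `0 ≤ l`. -/
def prox {d : ℕ} (R : E d → ℝ) (l : ℝ) (z : E d) : E d :=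
  Classical.epsilon fun w => IsProx R l z w

/-- `M_{τ+1} = ρ M_τ + η (σ √n₀ + γ) / √n`. -/
def errBound (n : ℕ) (f : ℝ → ℝ) (η n₀ ρ M₀ : ℝ) : ℕ → ℝ
  | 0 => M₀
  | τ + 1 => ρ * errBound n f η n₀ ρ M₀ τ
      + η * (sigmaTerm f * √n₀ + gammaTerm f) / √(n : ℝ)

/-- Shrinkage parameter `λ_τ = ((1 + t / b_n) M + η σ) l / b_n`, as a function of `M = M_τ`. -/
def shrinkage (n : ℕ) (f : ℝ → ℝ) (η t l M : ℝ) : ℝ :=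
  ((1 + t / gaussNorm n) * M + η * sigmaTerm f) * l / gaussNorm n

/-- Observations `y = f(X θ)`, with `f` acting entrywise. -/
def observe {n d : ℕ} (f : ℝ → ℝ) (X : Matrix (Fin n) (Fin d) ℝ) (θ : E d) : Fin n → ℝ :=
  fun i => f ((X *ᵥ θ.ofLp) i)

/-- `θ + α Xᵀ (y - X θ)`. -/
def gradStep {n d : ℕ} (α : ℝ) (X : Matrix (Fin n) (Fin d) ℝ) (y : Fin n → ℝ) (θ : E d) : E d :=
  θ + α • WithLp.toLp 2 (Xᵀ *ᵥ (y - X *ᵥ θ.ofLp))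

/-- The iterates `θ_{τ+1} = prox_{λ_τ}(θ_τ + b_n⁻² X_τᵀ (y_τ - X_τ θ_τ))` with `y_τ = f(X_τ θ⋆)`,
for a sequence `X` of feature matrices and a sequence `lam` of shrinkage parameters. -/
def iterate {n d : ℕ} (R : E d → ℝ) (f : ℝ → ℝ) (θs θ₀ : E d) (lam : ℕ → ℝ)
    (X : ℕ → Matrix (Fin n) (Fin d) ℝ) : ℕ → E d
  | 0 => θ₀
  | τ + 1 => prox R (lam τ)
      (gradStep (1 / gaussNorm n ^ 2) (X τ) (observe f (X τ) θs) (iterate R f θs θ₀ lam X τ))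

end ProxGD

end

/-! Fix the current iterate and put h = θ - μθ*, w = f(Xθ*) - μXθ*, v = w - Xh, b = b_n, so that the
gradient step is θ + b⁻²Xᵀv. For every s ∈ ∂R(μθ*), optimality of the proximal point gives the error
bound ‖h + b⁻²Xᵀv - λ_τ s‖ (`norm_prox_sub_le`). With K = span{θ*, h} this vector is the sum of
P_K(h - b⁻²XᵀXh), b⁻²P_K Xᵀw and b⁻²(P_{K⊥}Xᵀv - b²λ_τ s).

Since dim K ≤ 2, the first two terms reduce to a few scalar tail bounds. For the third, v depends
only on X restricted to K, hence is independent of X on K⊥; given v, P_{K⊥}Xᵀv is distributed as ‖v‖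
P_{K⊥}g with g standard Gaussian. The shrinkage is tuned so that b²λ_τ = Vλ with V ≥ ‖v‖, and a good
s leaves V times the distance from (‖v‖/V)P_{K⊥}g to λ∂R(μθ*). Contraction and projection do not
increase Gaussian means of convex functions, so this distance is at most 𝒢 + 2t with high
probability (`stdGaussian_infDist_gt_le`). The concentration comes from a discretized Maurey–Pisier
rotation, which needs only subgradients of the distance.

Altogether the error contracts by (𝒢 + 7t)/b (`norm_prox_gradStep_sub_le`). As b = φ(n) and φ(s)²/s
is nondecreasing, this factor is at most √(n₀/n) (`phi_le_mul_sqrt`). Each batch is independent of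
the iterate it acts on, so the one-step bound applies conditionally, and a union bound over the
steps finishes. -/

/-! ### Subgradients of the distance to a closed convex set. -/

section ConvexAnalysis

variable {F : Type*} [NormedAddCommGroup F] [InnerProductSpace ℝ F]

/-- Variational inequality for a nearest point of a convex set. -/
lemma inner_sub_le_zero_of_infDist_eq {S : Set F} (hS : Convex ℝ S) {x p : F} (hp : p ∈ S)
    (h : Metric.infDist x S = dist x p) {w : F} (hw : w ∈ S) : inner ℝ (x - p) (w - p) ≤ 0 := by
  refine (norm_eq_iInf_iff_real_inner_le_zero hS hp).1 ?_ w hw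
  rw [← dist_eq_norm, ← h, Metric.infDist_eq_iInf]
  simp only [dist_eq_norm]

/-- A measurable selection of subgradients of the distance to a closed convex set. -/
lemma exists_measurable_subgradient_infDist [FiniteDimensional ℝ F] [MeasurableSpace F]
    [BorelSpace F] {S : Set F} (hS : Convex ℝ S) (hc : IsClosed S) (hne : S.Nonempty) :
    ∃ v : F → F, Measurable v ∧ (∀ x, ‖v x‖ ≤ 1) ∧
      ∀ x y, Metric.infDist x S - Metric.infDist y S ≤ inner ℝ (v x) (x - y) := by
  have : ProperSpace F := FiniteDimensional.proper_real F
  choose q hqS hq using fun x : F => hc.exists_infDist_eq_dist hne x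
  have hvar : ∀ x w, w ∈ S → inner ℝ (x - q x) (w - q x) ≤ 0 := fun x w hw =>
    inner_sub_le_zero_of_infDist_eq hS (hqS x) (hq x) hw
  -- Adding the variational inequalities at `x` and `y` shows that the nearest-point map is
  -- nonexpansive; this is what makes `v` measurable.
  have hlip : LipschitzWith 1 q := by
    refine LipschitzWith.of_dist_le_mul fun x y => ?_
    have h1 := hvar x (q y) (hqS y)
    have h2 := hvar y (q x) (hqS x)
    have h3 : ‖q x - q y‖ ^ 2 ≤ inner ℝ (x - y) (q x - q y) := by
      have : inner ℝ (x - y) (q x - q y) - ‖q x - q y‖ ^ 2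
          = -inner ℝ (x - q x) (q y - q x) - inner ℝ (y - q y) (q x - q y) := by
        rw [← real_inner_self_eq_norm_sq]
        simp only [inner_sub_left, inner_sub_right]
        ring
      linarith
    have h4 := real_inner_le_norm (x - y) (q x - q y)
    simp only [NNReal.coe_one, one_mul, dist_eq_norm]
    by_contra! hlt
    nlinarith [norm_nonneg (x - y), norm_nonneg (q x - q y)]
  -- The outward unit normal off `S`. On `S` the convention `0⁻¹ = 0` gives `v = 0`, a subgradient
  -- because the distance is nonnegative.
  refine ⟨fun x => (Metric.infDist x S)⁻¹ • (x - q x), ?_, fun x => ?_, fun x y => ?_⟩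
  · exact (Metric.continuous_infDist_pt S).measurable.inv.smul
      (measurable_id.sub hlip.continuous.measurable)
  · rw [norm_smul, norm_inv, ← dist_eq_norm, ← hq x, Real.norm_of_nonneg Metric.infDist_nonneg]
    exact inv_mul_le_one
  · rcases (Metric.infDist_nonneg (x := x) (s := S)).eq_or_lt with h0 | h0
    · simp only [← h0, inv_zero, zero_smul, inner_zero_left, zero_sub, Left.neg_nonpos_iff]
      exact Metric.infDist_nonneg
    · have hx := hq x
      have hy := hq y
      rw [dist_eq_norm] at hx hy
      have h1 := hvar x (q y) (hqS y)
      have h2 : inner ℝ (x - q x) (y - q y) ≤ Metric.infDist x S * Metric.infDist y S := by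
        rw [hx, hy]; exact real_inner_le_norm _ _
      rw [real_inner_smul_left, inv_mul_eq_div, le_div_iff₀ h0]
      have h3 : inner ℝ (x - q x) (x - q x) = Metric.infDist x S ^ 2 := by
        rw [real_inner_self_eq_norm_sq, hx]
      have h4 : inner ℝ (x - q x) (x - y) = inner ℝ (x - q x) (x - q x)
          - inner ℝ (x - q x) (y - q y) - inner ℝ (x - q x) (q y - q x) := by
        simp only [inner_sub_right]; ring
      nlinarith

/-- Average the two subgradient inequalities based at the intermediate point; their linear terms
cancel. -/
lemma le_of_subgradient_convex_comb {D : F → ℝ} {v : F → F}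
    (hv : ∀ x y, D x - D y ≤ inner ℝ (v x) (x - y)) {a b : ℝ} (ha : 0 ≤ a) (hb : 0 ≤ b)
    (hab : a + b = 1) (x y : F) : D (a • x + b • y) ≤ a * D x + b * D y := by
  set m := a • x + b • y with hm
  have h1 := mul_le_mul_of_nonneg_left (hv m x) ha
  have h2 := mul_le_mul_of_nonneg_left (hv m y) hb
  have h3 : a * inner ℝ (v m) (m - x) + b * inner ℝ (v m) (m - y) = 0 := by
    rw [← real_inner_smul_right, ← real_inner_smul_right, ← inner_add_right]
    have : a • (m - x) + b • (m - y) = 0 := by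
      have : a • (m - x) + b • (m - y) = (a + b) • m - (a • x + b • y) := by module
      rw [this, hab, one_smul, ← hm, sub_self]
    rw [this, inner_zero_right]
  have h4 : D m = a * D m + b * D m := by rw [← add_mul, hab, one_mul]
  linarith

end ConvexAnalysis

/-! ### Subdifferentials and the proximal map. -/

namespace ProxGD

variable {d : ℕ} {R : E d → ℝ}

lemma continuous_of_convexOn_univ (hR : ConvexOn ℝ Set.univ R) : Continuous R :=
  hR.locallyLipschitz.continuous

/-- Hahn–Banach separates `(x, R x)` from the strict epigraph, which is open because `R` is
continuous. The separating functional is not horizontal, so it can be normalized to a subgradient.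
-/
lemma subdiff_nonempty (hR : ConvexOn ℝ Set.univ R) (x : E d) : (subdiff R x).Nonempty := by
  have hcont := continuous_of_convexOn_univ hR
  have hconv : Convex ℝ {z : E d × ℝ | z.1 ∈ Set.univ ∧ R z.1 < z.2} :=
    hR.convex_strict_epigraph
  have hopen : IsOpen {z : E d × ℝ | z.1 ∈ Set.univ ∧ R z.1 < z.2} := by
    simp only [Set.mem_univ, true_and]
    exact isOpen_lt (hcont.comp continuous_fst) continuous_snd
  obtain ⟨f, hf⟩ := geometric_hahn_banach_open_point hconv hopen (x := (x, R x)) (by simp)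
  have hsplit : ∀ y r, f (y, r) = f (y, 0) + r * f (0, 1) := fun y r => by
    have : ((y, r) : E d × ℝ) = (y, 0) + r • (0, 1) := by simp
    rw [this, map_add, map_smul, smul_eq_mul]
  have hc : f (0, 1) < 0 := by
    have := hf (x, R x + 1) (by simp)
    rw [hsplit x (R x + 1), hsplit x (R x)] at this
    linarith
  set c := f (0, 1) with hcdef
  let g : E d →L[ℝ] ℝ := (-c)⁻¹ • f.comp (ContinuousLinearMap.inl ℝ (E d) ℝ)
  refine ⟨(InnerProductSpace.toDual ℝ (E d)).symm g, fun y => ?_⟩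
  rw [InnerProductSpace.toDual_symm_apply]
  have h1 : ∀ r, R y < r → f (y, 0) + r * c < f (x, 0) + R x * c := fun r hr => by
    have := hf (y, r) (by simpa using hr)
    rwa [hsplit y r, hsplit x (R x)] at this
  have h2 : f (y, 0) + R y * c ≤ f (x, 0) + R x * c := by
    refine le_of_forall_pos_le_add fun ε hε => ?_
    have := h1 (R y + ε / (-c)) (by have := div_pos hε (neg_pos.2 hc); linarith)
    have h3 : (R y + ε / (-c)) * c = R y * c - ε := by
      field_simp [hc.ne]; ring
    linarith
  have h4 : g (y - x) = (-c)⁻¹ * (f (y, 0) - f (x, 0)) := by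
    simp only [g, _root_.smul_apply, ContinuousLinearMap.comp_apply,
      ContinuousLinearMap.inl_apply, smul_eq_mul]
    rw [← map_sub]; simp
  rw [h4, inv_mul_eq_div]
  have : (f (y, 0) - f (x, 0)) / (-c) ≤ R y - R x := by
    rw [div_le_iff₀ (neg_pos.2 hc)]; linarith
  linarith

lemma convex_subdiff (R : E d → ℝ) (x : E d) : Convex ℝ (subdiff R x) := by
  intro u hu v hv a b ha hb hab y
  have h1 := mul_le_mul_of_nonneg_left (hu y) ha
  have h2 := mul_le_mul_of_nonneg_left (hv y) hb
  rw [inner_add_left, real_inner_smul_left, real_inner_smul_left]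
  have h3 : R x = a * R x + b * R x := by rw [← add_mul, hab, one_mul]
  have h4 : R y = a * R y + b * R y := by rw [← add_mul, hab, one_mul]
  linarith

lemma isClosed_subdiff (R : E d → ℝ) (x : E d) : IsClosed (subdiff R x) := by
  have : subdiff R x = ⋂ y, {v | R x + inner ℝ v (y - x) ≤ R y} := by
    ext v; simp [subdiff]
  rw [this]
  exact isClosed_iInter fun y => isClosed_le (by fun_prop) continuous_const

lemma isClosed_smul_subdiff (R : E d → ℝ) (x : E d) (l : ℝ) : IsClosed (l • subdiff R x) :=
  (isClosed_subdiff R x).smul₀ l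

/-- A subgradient `v` at `z` bounds `R` below by an affine function, so outside the ball of radius
`2 * l * ‖v‖` the quadratic term lifts the objective above its value at `z`. Compactness of the ball
does the rest. -/
lemma exists_isProx (hR : ConvexOn ℝ Set.univ R) {l : ℝ} (hl : 0 ≤ l) (z : E d) :
    ∃ w, IsProx R l z w := by
  obtain ⟨v, hv⟩ := subdiff_nonempty hR z
  have hcont := continuous_of_convexOn_univ hR
  have hq : Continuous fun u => 1 / 2 * ‖z - u‖ ^ 2 + l * R u := by fun_prop
  obtain ⟨w, -, hw⟩ := (isCompact_closedBall z (2 * l * ‖v‖)).exists_isMinOn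
    ⟨z, Metric.mem_closedBall_self (by positivity)⟩ hq.continuousOn
  refine ⟨w, fun u _ => ?_⟩
  by_cases hu : u ∈ Metric.closedBall z (2 * l * ‖v‖)
  · exact hw hu
  · have hz := hw (Metric.mem_closedBall_self (by positivity : 0 ≤ 2 * l * ‖v‖))
    simp only [Set.mem_ofPred_eq, sub_self, norm_zero] at hz ⊢
    rw [Metric.mem_closedBall, dist_eq_norm, not_le, norm_sub_rev] at hu
    have h1 := hv u
    have h2 := neg_le_of_abs_le (abs_real_inner_le_norm v (u - z))
    rw [norm_sub_rev u z] at h2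
    have h3 : l * (R z - ‖v‖ * ‖z - u‖) ≤ l * R u :=
      mul_le_mul_of_nonneg_left (by linarith) hl
    nlinarith [norm_nonneg (z - u)]

lemma isProx_prox (hR : ConvexOn ℝ Set.univ R) {l : ℝ} (hl : 0 ≤ l) (z : E d) :
    IsProx R l z (prox R l z) :=
  Classical.epsilon_spec (exists_isProx hR hl z)

/-- First-order optimality: compare `w` with `(1 - s) • w + s • u`, divide by `s` and let `s` tend
to zero. -/
lemma IsProx.inner_le (hR : ConvexOn ℝ Set.univ R) {l : ℝ} (hl : 0 ≤ l) {z w : E d}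
    (hw : IsProx R l z w) (u : E d) : inner ℝ (z - w) (u - w) ≤ l * (R u - R w) := by
  have key : ∀ s : ℝ, 0 < s → s ≤ 1 →
      inner ℝ (z - w) (u - w) ≤ l * (R u - R w) + s * (‖u - w‖ ^ 2 / 2) := by
    intro s hs hs1
    have h1 := hw (Set.mem_univ ((1 - s) • w + s • u))
    simp only [Set.mem_ofPred_eq] at h1
    have h2 := mul_le_mul_of_nonneg_left
      (hR.2 (Set.mem_univ w) (Set.mem_univ u) (sub_nonneg.2 hs1) hs.le (by ring)) hl
    simp only [smul_eq_mul] at h2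
    have h3 : z - ((1 - s) • w + s • u) = (z - w) - s • (u - w) := by module
    rw [h3, norm_sub_sq_real (z - w), real_inner_smul_right, norm_smul, Real.norm_of_nonneg hs.le] at h1
    have h4 : s * inner ℝ (z - w) (u - w)
        ≤ s * (l * (R u - R w) + s * (‖u - w‖ ^ 2 / 2)) := by nlinarith
    exact le_of_mul_le_mul_left h4 hs
  refine le_of_forall_pos_le_add fun ε hε => ?_
  set q := ‖u - w‖ ^ 2 / 2
  have hq : 0 ≤ q := by positivity
  have := key (min 1 (ε / (q + 1))) (by positivity) (min_le_left _ _)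
  have h2 : min 1 (ε / (q + 1)) * q ≤ ε := by
    calc min 1 (ε / (q + 1)) * q ≤ ε / (q + 1) * q := by gcongr; exact min_le_right _ _
      _ ≤ ε := by rw [div_mul_eq_mul_div, div_le_iff₀ (by positivity)]; nlinarith
  linarith

/-- Serves only to make the iterates measurable functions of the batches. -/
lemma lipschitzWith_prox (hR : ConvexOn ℝ Set.univ R) {l : ℝ} (hl : 0 ≤ l) :
    LipschitzWith 1 (prox R l) := by
  refine LipschitzWith.of_dist_le_mul fun x y => ?_
  have h1 := (isProx_prox hR hl x).inner_le hR hl (prox R l y)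
  have h2 := (isProx_prox hR hl y).inner_le hR hl (prox R l x)
  set a := prox R l x
  set b := prox R l y
  have h3 : ‖a - b‖ ^ 2 ≤ inner ℝ (x - y) (a - b) := by
    have : inner ℝ (x - y) (a - b) - ‖a - b‖ ^ 2
        = -inner ℝ (x - a) (b - a) - inner ℝ (y - b) (a - b) := by
      rw [← real_inner_self_eq_norm_sq]
      simp only [inner_sub_left, inner_sub_right]
      ring
    linarith
  have h4 := real_inner_le_norm (x - y) (a - b)
  simp only [NNReal.coe_one, one_mul, dist_eq_norm]
  by_contra! hlt
  nlinarith [norm_nonneg (x - y), norm_nonneg (a - b)]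

/-- The proximal point is at least as close to `x` as `z - l • s` is, for any subgradient `s`
at `x`. -/
lemma norm_prox_sub_le (hR : ConvexOn ℝ Set.univ R) {l : ℝ} (hl : 0 ≤ l) (z x : E d) {s : E d}
    (hs : s ∈ subdiff R x) : ‖prox R l z - x‖ ≤ ‖z - x - l • s‖ := by
  have h1 := (isProx_prox hR hl z).inner_le hR hl x
  set w := prox R l z
  have h2 := mul_le_mul_of_nonneg_left (hs w) hl
  have h3 : ‖w - x‖ ^ 2 ≤ inner ℝ (z - x - l • s) (w - x) := by
    have : inner ℝ (z - x - l • s) (w - x) - ‖w - x‖ ^ 2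
        = -inner ℝ (z - w) (x - w) - l * inner ℝ s (w - x) := by
      rw [← real_inner_self_eq_norm_sq]
      simp only [inner_sub_left, inner_sub_right, real_inner_smul_left]
      ring
    linarith
  have h4 := real_inner_le_norm (z - x - l • s) (w - x)
  by_contra! hlt
  nlinarith [norm_nonneg (z - x - l • s), norm_nonneg (w - x)]

end ProxGD

/-! ### The Gamma ratio φ and its inverse. -/

namespace ProxGD

section GammaRatio

open Filter Topology

lemma phi_pos {s : ℝ} (hs : 0 < s) : 0 < phi s := by
  have h1 := Real.Gamma_pos_of_pos (show 0 < (s + 1) / 2 by positivity)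
  have h2 := Real.Gamma_pos_of_pos (show 0 < s / 2 by positivity)
  unfold phi
  positivity

lemma phi_mul_phi_add_one {s : ℝ} (hs : 0 < s) : phi s * phi (s + 1) = s := by
  have h1 := Real.Gamma_pos_of_pos (show 0 < (s + 1) / 2 by positivity)
  have h2 := Real.Gamma_pos_of_pos (show 0 < s / 2 by positivity)
  have h3 : Real.Gamma ((s + 1 + 1) / 2) = s / 2 * Real.Gamma (s / 2) := by
    rw [← Real.Gamma_add_one (by positivity)]
    congr 1
    ring
  have h4 : √2 * √2 = (2 : ℝ) := Real.mul_self_sqrt (by norm_num)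
  unfold phi
  rw [h3]
  field_simp
  linear_combination h4

lemma phi_add_two {s : ℝ} (hs : 0 < s) : phi (s + 2) = phi s * ((s + 1) / s) := by
  have h1 := phi_mul_phi_add_one hs
  have h2 := phi_mul_phi_add_one (show 0 < s + 1 by positivity)
  have h3 := phi_pos (show 0 < s + 1 by positivity)
  rw [show s + 1 + 1 = s + 2 by ring] at h2
  have h4 : phi s = s / phi (s + 1) := by field_simp; linarith
  rw [h4]
  field_simp
  linarith

/-- Log-convexity of Γ at `(s + 1) / 2`, the midpoint of `s / 2` and `s / 2 + 1`. -/
lemma phi_sq_le {s : ℝ} (hs : 0 < s) : phi s ^ 2 ≤ s := by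
  have h1 := Real.Gamma_pos_of_pos (show 0 < (s + 1) / 2 by positivity)
  have h2 := Real.Gamma_pos_of_pos (show 0 < s / 2 by positivity)
  have h := Real.Gamma_mul_add_mul_le_rpow_Gamma_mul_rpow_Gamma (s := s / 2) (t := s / 2 + 1)
    (a := 1 / 2) (b := 1 / 2) (by positivity) (by positivity) (by norm_num) (by norm_num)
    (by norm_num)
  rw [Real.Gamma_add_one (by positivity), ← Real.sqrt_eq_rpow, ← Real.sqrt_eq_rpow,
    ← Real.sqrt_mul h2.le, show 1 / 2 * (s / 2) + 1 / 2 * (s / 2 + 1) = (s + 1) / 2 by ring] at h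
  have h5 := Real.sq_sqrt (show 0 ≤ Real.Gamma (s / 2) * (s / 2 * Real.Gamma (s / 2)) by positivity)
  have h6 := pow_le_pow_left₀ h1.le h 2
  rw [h5] at h6
  unfold phi
  rw [div_pow, mul_pow, Real.sq_sqrt (by norm_num), div_le_iff₀ (by positivity)]
  nlinarith

lemma div_add_one_le_phi_sq_div {s : ℝ} (hs : 0 < s) : s / (s + 1) ≤ phi s ^ 2 / s := by
  have h1 := phi_mul_phi_add_one hs
  have h2 := phi_sq_le (show 0 < s + 1 by positivity)
  have h3 := phi_pos hs
  have h4 : s ^ 2 = phi s ^ 2 * phi (s + 1) ^ 2 := by rw [← mul_pow, h1]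
  rw [div_le_div_iff₀ (by positivity) hs]
  nlinarith [sq_nonneg (phi s)]

lemma phi_sq_div_add_two {s : ℝ} (hs : 0 < s) :
    phi (s + 2) ^ 2 / (s + 2) = phi s ^ 2 / s * ((s + 1) ^ 2 / (s * (s + 2))) := by
  rw [phi_add_two hs]
  field_simp

/-- The shift `s ↦ s + 2` multiplies φ(s)²/s by 1 + 1/(s(s+2)), which decreases in `s`, so the
smaller argument gains more at every shift. Both quantities tend to 1 under repeated shifts, hence
the smaller argument started lower. -/
lemma phi_sq_div_le {x y : ℝ} (hx : 0 < x) (hxy : x ≤ y) : phi x ^ 2 / x ≤ phi y ^ 2 / y := by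
  have hy := hx.trans_le hxy
  have key : ∀ N : ℕ, phi x ^ 2 / x * (phi (y + 2 * N) ^ 2 / (y + 2 * N))
      ≤ phi y ^ 2 / y * (phi (x + 2 * N) ^ 2 / (x + 2 * N)) := by
    intro N
    induction N with
    | zero => simp [mul_comm]
    | succ N ih =>
      have hx' : 0 < x + 2 * N := by positivity
      have hy' : 0 < y + 2 * N := by positivity
      push_cast
      rw [show y + 2 * ((N : ℝ) + 1) = y + 2 * N + 2 by ring,
        show x + 2 * ((N : ℝ) + 1) = x + 2 * N + 2 by ring, phi_sq_div_add_two hx',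
        phi_sq_div_add_two hy', ← mul_assoc, ← mul_assoc]
      refine mul_le_mul ih ?_ (by positivity) (by positivity)
      have hle : x + 2 * N ≤ y + 2 * N := by linarith
      rw [div_le_div_iff₀ (by positivity) (by positivity)]
      nlinarith [mul_pos hx' hy']
  have hbound : ∀ N : ℕ, phi x ^ 2 / x * ((y + 2 * N) / (y + 2 * N + 1)) ≤ phi y ^ 2 / y := by
    intro N
    have hx' : 0 < x + 2 * N := by positivity
    have hy' : 0 < y + 2 * N := by positivity
    calc phi x ^ 2 / x * ((y + 2 * N) / (y + 2 * N + 1))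
        ≤ phi x ^ 2 / x * (phi (y + 2 * N) ^ 2 / (y + 2 * N)) := by
          exact mul_le_mul_of_nonneg_left (div_add_one_le_phi_sq_div hy') (by positivity)
      _ ≤ _ := key N
      _ ≤ phi y ^ 2 / y * 1 := by
          gcongr
          exact div_le_one_of_le₀ (phi_sq_le hx') hx'.le
      _ = _ := mul_one _
  have hlim : Tendsto (fun N : ℕ => phi x ^ 2 / x * ((y + 2 * N) / (y + 2 * N + 1))) atTop
      (𝓝 (phi x ^ 2 / x * 1)) := by
    refine Tendsto.const_mul _ ?_
    have : ∀ N : ℕ, (y + 2 * N) / (y + 2 * N + 1) = 1 - (y + 2 * N + 1)⁻¹ := fun N => by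
      have : y + 2 * N + 1 ≠ 0 := by positivity
      field_simp
      ring
    simp_rw [this]
    rw [show 𝓝 (1 : ℝ) = 𝓝 (1 - 0) by simp]
    refine tendsto_const_nhds.sub (tendsto_inv_atTop_zero.comp ?_)
    refine tendsto_atTop_add_const_right _ _ (tendsto_atTop_add_const_left _ _ ?_)
    exact tendsto_natCast_atTop_atTop.const_mul_atTop (by norm_num)
  rw [mul_one] at hlim
  exact le_of_tendsto hlim (Eventually.of_forall hbound)

lemma phi_le_mul_sqrt {x y : ℝ} (hx : 0 < x) (hxy : x ≤ y) : phi x ≤ phi y * √(x / y) := by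
  have hy := hx.trans_le hxy
  have h := phi_sq_div_le hx hxy
  refine abs_le_of_sq_le_sq' ?_ (by have := phi_pos hy; positivity) |>.2
  rw [mul_pow, Real.sq_sqrt (by positivity)]
  rw [div_le_div_iff₀ hx hy] at h
  rw [mul_div_assoc', le_div_iff₀ hy]
  exact h

lemma phi_le_sqrt {s : ℝ} (hs : 0 < s) : phi s ≤ √s :=
  Real.le_sqrt_of_sq_le (phi_sq_le hs)

lemma sqrt_sub_le_phi {s : ℝ} (hs : 1 ≤ s) : √s * (1 - 1 / (2 * s)) ≤ phi s := by
  have hs0 : 0 < s := by linarith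
  have h := div_add_one_le_phi_sq_div hs0
  refine abs_le_of_sq_le_sq' ?_ (phi_pos hs0).le |>.2
  rw [mul_pow, Real.sq_sqrt hs0.le]
  have h2 : (1 - 1 / (2 * s)) ^ 2 ≤ s / (s + 1) := by
    rw [le_div_iff₀ (by positivity)]
    have : (1 - 1 / (2 * s)) ^ 2 * (s + 1) = s - (3 * s - 1) / (4 * s ^ 2) := by
      field_simp; ring
    rw [this]
    have : 0 ≤ (3 * s - 1) / (4 * s ^ 2) := div_nonneg (by linarith) (by positivity)
    linarith
  calc s * (1 - 1 / (2 * s)) ^ 2 ≤ s * (phi s ^ 2 / s) := by gcongr; exact h2.trans h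
    _ = phi s ^ 2 := by field_simp

lemma exists_phi_eq {c : ℝ} (hc : 1 ≤ c) : ∃ s ∈ Set.Ioi (0 : ℝ), phi s = c := by
  have hcont : ContinuousOn phi (Set.Icc 1 (c ^ 2 + 1)) := by
    intro s hs
    have hs0 : 0 < s := by linarith [hs.1]
    have hG : ∀ x : ℝ, 0 < x → ContinuousAt Real.Gamma x := fun x hx =>
      (Real.differentiableAt_Gamma fun m => by
        have : (0 : ℝ) ≤ m := m.cast_nonneg
        linarith).continuousAt
    refine ContinuousAt.continuousWithinAt ?_
    unfold phi
    refine ContinuousAt.div (continuousAt_const.mul ?_) ?_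
      (Real.Gamma_pos_of_pos (by positivity)).ne'
    · exact ContinuousAt.comp (f := fun s : ℝ => (s + 1) / 2) (hG _ (by positivity)) (by fun_prop)
    · exact ContinuousAt.comp (f := fun s : ℝ => s / 2) (hG _ (by positivity)) (by fun_prop)
  have h1 : phi 1 ≤ c := by
    have := phi_sq_le one_pos
    nlinarith [phi_pos one_pos]
  -- The right endpoint K = c² + 1 works because φ(K)² ≥ K²/(K+1) ≥ c².
  have hK : 0 < c ^ 2 + 1 := by positivity
  have h2 : c ≤ phi (c ^ 2 + 1) := by
    have h := div_add_one_le_phi_sq_div hK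
    rw [div_le_div_iff₀ (by positivity) hK] at h
    refine abs_le_of_sq_le_sq' ?_ (phi_pos hK).le |>.2
    by_contra! hlt
    nlinarith
  obtain ⟨s, hs, rfl⟩ := intermediate_value_Icc (by nlinarith) hcont ⟨h1, h2⟩
  exact ⟨s, lt_of_lt_of_le one_pos hs.1, rfl⟩

/-- The summand `√2` places the target above 1, where a preimage under φ was found. Any preimage
will do. -/
lemma minSamples_spec {d : ℕ} (R : E d → ℝ) (x : E d) (l : ℝ) {t : ℝ} (ht : 0 ≤ t) :
    0 < minSamples R x l t ∧ phi (minSamples R x l t) = gaussDist R x l + 7 * t + √2 := by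
  have h : ∃ s ∈ Set.Ioi (0 : ℝ), phi s = gaussDist R x l + 7 * t + √2 := by
    refine exists_phi_eq ?_
    have h1 : 0 ≤ gaussDist R x l := Real.sqrt_nonneg _
    have h2 : (1 : ℝ) ≤ √2 := Real.one_le_sqrt.2 (by norm_num)
    linarith
  exact ⟨Function.invFunOn_mem h, Function.invFunOn_eq h⟩

end GammaRatio

end ProxGD

/-! ### Standard Gaussian measures: linear images, density, norm tails. -/

section StdGaussian

open Real

variable {F : Type*} [NormedAddCommGroup F] [InnerProductSpace ℝ F] [FiniteDimensional ℝ F]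
  [MeasurableSpace F] [BorelSpace F]
variable {F' : Type*} [NormedAddCommGroup F'] [InnerProductSpace ℝ F'] [FiniteDimensional ℝ F']
  [MeasurableSpace F'] [BorelSpace F']
variable {K : Type*} [NormedAddCommGroup K] [InnerProductSpace ℝ K] [FiniteDimensional ℝ K]
  [MeasurableSpace K] [BorelSpace K]

omit [FiniteDimensional ℝ F] [BorelSpace F] in
lemma charFun_map_of_adjoint (μ : Measure F) {A : F → K} (hAm : Measurable A) {A' : K → F}
    (hA : ∀ x k, inner ℝ (A x) k = inner ℝ x (A' k)) (k : K) :
    charFun (μ.map A) k = charFun μ (A' k) := by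
  rw [charFun_apply, charFun_apply, integral_map hAm.aemeasurable (by fun_prop)]
  simp_rw [hA]

/-- A linear image of a standard Gaussian under a coisometry is a standard Gaussian. -/
lemma map_stdGaussian_of_adjoint {A : F → K} (hAm : Measurable A) {A' : K → F}
    (hA : ∀ x k, inner ℝ (A x) k = inner ℝ x (A' k)) (hn : ∀ k, ‖A' k‖ = ‖k‖) :
    (stdGaussian F).map A = stdGaussian K := by
  have := Measure.isProbabilityMeasure_map (μ := stdGaussian F) hAm.aemeasurable
  refine Measure.ext_of_charFun (funext fun k => ?_)
  rw [charFun_map_of_adjoint _ hAm hA, charFun_stdGaussian, charFun_stdGaussian, hn]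

/-- `A x + B y` is a standard Gaussian if `x` and `y` are independent standard Gaussians and
`A A* + B B* = 1`. -/
lemma map_prod_stdGaussian_of_adjoint {A : F → K} {B : F' → K} (hAm : Measurable A)
    (hBm : Measurable B) {A' : K → F} {B' : K → F'}
    (hA : ∀ x k, inner ℝ (A x) k = inner ℝ x (A' k))
    (hB : ∀ x k, inner ℝ (B x) k = inner ℝ x (B' k))
    (hn : ∀ k, ‖A' k‖ ^ 2 + ‖B' k‖ ^ 2 = ‖k‖ ^ 2) :
    ((stdGaussian F).prod (stdGaussian F')).map (fun z => A z.1 + B z.2) = stdGaussian K := by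
  have h1 := Measure.isProbabilityMeasure_map (μ := stdGaussian F) hAm.aemeasurable
  have h2 := Measure.isProbabilityMeasure_map (μ := stdGaussian F') hBm.aemeasurable
  have hcomp : ((stdGaussian F).prod (stdGaussian F')).map (fun z => A z.1 + B z.2)
      = (((stdGaussian F).map A).prod ((stdGaussian F').map B)).map (fun p => p.1 + p.2) := by
    rw [Measure.map_prod_map _ _ hAm hBm, Measure.map_map (by fun_prop) (by fun_prop)]
    rfl
  rw [hcomp]
  have := Measure.isProbabilityMeasure_map
    (μ := ((stdGaussian F).map A).prod ((stdGaussian F').map B)) (f := fun p => p.1 + p.2)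
    (by fun_prop)
  refine Measure.ext_of_charFun (funext fun k => ?_)
  rw [charFun_map_add_prod_eq_mul, Pi.mul_apply, charFun_map_of_adjoint _ hAm hA,
    charFun_map_of_adjoint _ hBm hB, charFun_stdGaussian, charFun_stdGaussian,
    charFun_stdGaussian, ← Complex.exp_add]
  congr 1
  rw [← Complex.ofReal_pow, ← Complex.ofReal_pow, ← Complex.ofReal_pow, ← hn k]
  push_cast
  ring

lemma map_inner_stdGaussian (w : F) :
    (stdGaussian F).map (fun x => inner ℝ w x) = gaussianReal 0 (‖w‖₊ ^ 2) := by
  have h := IsGaussian.map_eq_gaussianReal (μ := stdGaussian F) (innerSL ℝ w)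
  rw [integral_strongDual_stdGaussian, variance_dual_stdGaussian, innerSL_apply_norm] at h
  have h2 : (‖w‖ ^ 2).toNNReal = ‖w‖₊ ^ 2 := by
    ext
    simp [Real.coe_toNNReal _ (sq_nonneg ‖w‖)]
  rw [h2] at h
  exact h

lemma mgf_inner_stdGaussian (w : F) (s : ℝ) :
    mgf (fun x => inner ℝ w x) (stdGaussian F) s = exp (‖w‖ ^ 2 * s ^ 2 / 2) := by
  rw [mgf_gaussianReal (map_inner_stdGaussian w)]
  simp

lemma integrable_exp_mul_inner_stdGaussian (w : F) (s : ℝ) :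
    Integrable (fun x => exp (s * inner ℝ w x)) (stdGaussian F) := by
  rw [← mgf_pos_iff, mgf_inner_stdGaussian]
  exact exp_pos _

lemma stdGaussian_abs_inner_gt_le (w : F) {t : ℝ} (ht : 0 ≤ t) :
    (stdGaussian F).real {x | t * ‖w‖ < |inner ℝ w x|} ≤ 2 * exp (-t ^ 2 / 2) := by
  rcases eq_or_ne w 0 with rfl | hw
  · have : {x : F | t * ‖(0 : F)‖ < |inner ℝ (0 : F) x|} = ∅ := by ext; simp
    rw [this]
    simp
    positivity
  have hw' : 0 < ‖w‖ := norm_pos_iff.2 hw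
  have one : ∀ u : F, ‖u‖ = ‖w‖ →
      (stdGaussian F).real {x | t * ‖w‖ ≤ inner ℝ u x} ≤ exp (-t ^ 2 / 2) := by
    intro u hu
    refine (measure_ge_le_exp_mul_mgf (t * ‖w‖) (t := t / ‖w‖) (by positivity)
      (integrable_exp_mul_inner_stdGaussian u _)).trans ?_
    rw [mgf_inner_stdGaussian, ← exp_add, hu]
    refine exp_le_exp.2 (le_of_eq ?_)
    field_simp
    ring
  have hsub : {x : F | t * ‖w‖ < |inner ℝ w x|}
      ⊆ {x | t * ‖w‖ ≤ inner ℝ w x} ∪ {x | t * ‖w‖ ≤ inner ℝ (-w) x} := by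
    intro x hx
    rcases lt_abs.1 (show t * ‖w‖ < |inner ℝ w x| from hx) with h | h
    · exact Or.inl h.le
    · refine Or.inr ?_
      simp only [Set.mem_ofPred_eq, inner_neg_left]
      exact h.le
  refine (measureReal_mono hsub).trans ((measureReal_union_le _ _).trans ?_)
  linarith [one w rfl, one (-w) (norm_neg w)]

/-- Both measures are finite with the same characteristic function. The density gives access to the
law of the norm. -/
lemma stdGaussian_eq_withDensity :
    stdGaussian F = (volume : Measure F).withDensity fun x =>
      ENNReal.ofReal ((2 * π) ^ (-(Module.finrank ℝ F / 2 : ℝ)) * exp (-(1 / 2) * ‖x‖ ^ 2)) := by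
  set C : ℝ := (2 * π) ^ (-(Module.finrank ℝ F / 2 : ℝ)) with hC
  have hC0 : 0 < C := by positivity
  have hmeas : Measurable fun x : F => ENNReal.ofReal (C * exp (-(1 / 2) * ‖x‖ ^ 2)) := by
    fun_prop
  have hint : Integrable (fun x : F => exp (-(1 / 2) * ‖x‖ ^ 2)) := by
    have h := GaussianFourier.integrable_cexp_neg_mul_sq_norm_add (V := F) (b := (1 / 2 : ℂ))
      (by norm_num) 0 0
    refine (h.re).congr (Filter.Eventually.of_forall fun x => ?_)
    simp only [zero_mul, add_zero]
    rw [show -(1 / 2 : ℂ) * (‖x‖ : ℂ) ^ 2 = ((-(1 / 2) * ‖x‖ ^ 2 : ℝ) : ℂ) by push_cast; ring,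
      ← Complex.ofReal_exp]
    exact Complex.ofReal_re _
  have hfin : IsFiniteMeasure ((volume : Measure F).withDensity fun x =>
      ENNReal.ofReal (C * exp (-(1 / 2) * ‖x‖ ^ 2))) := by
    refine isFiniteMeasure_withDensity ?_
    rw [← ofReal_integral_eq_lintegral_ofReal (hint.const_mul C)
      (Filter.Eventually.of_forall fun x => by positivity)]
    exact ENNReal.ofReal_ne_top
  refine Measure.ext_of_charFun (funext fun k => ?_)
  rw [charFun_stdGaussian, charFun_apply,
    integral_withDensity_eq_integral_toReal_smul hmeas
      (Filter.Eventually.of_forall fun x => ENNReal.ofReal_lt_top)]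
  have h := GaussianFourier.integral_cexp_neg_mul_sq_norm_add (V := F) (b := (1 / 2 : ℂ))
      (by norm_num) Complex.I k
  have heq : ∀ x : F, (ENNReal.ofReal (C * exp (-(1 / 2) * ‖x‖ ^ 2))).toReal •
      Complex.exp (inner ℝ x k * Complex.I)
      = C * Complex.exp (-(1 / 2) * ‖x‖ ^ 2 + Complex.I * inner ℝ k x) := by
    intro x
    rw [ENNReal.toReal_ofReal (by positivity), Complex.real_smul, Complex.ofReal_mul,
      Complex.ofReal_exp, mul_assoc, ← Complex.exp_add, real_inner_comm]
    congr 2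
    push_cast
    ring
  simp_rw [heq]
  rw [integral_const_mul, h, ← mul_assoc]
  have h1 : (C : ℂ) * ((π : ℂ) / (1 / 2)) ^ ((Module.finrank ℝ F : ℂ) / 2) = 1 := by
    have : ((π : ℂ) / (1 / 2)) ^ ((Module.finrank ℝ F : ℂ) / 2)
        = (((2 * π) ^ (Module.finrank ℝ F / 2 : ℝ) : ℝ) : ℂ) := by
      rw [Complex.ofReal_cpow (by positivity)]
      push_cast
      congr 1
      ring
    rw [this, ← Complex.ofReal_mul, hC, ← rpow_add (by positivity)]
    simp
  rw [h1, one_mul, Complex.I_sq]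
  congr 1
  ring

lemma integral_stdGaussian_eq (g : F → ℝ) :
    ∫ x, g x ∂(stdGaussian F) = (2 * π) ^ (-(Module.finrank ℝ F / 2 : ℝ)) *
      ∫ x, exp (-(1 / 2) * ‖x‖ ^ 2) * g x := by
  rw [stdGaussian_eq_withDensity, integral_withDensity_eq_integral_toReal_smul (by fun_prop)
      (Filter.Eventually.of_forall fun x => ENNReal.ofReal_lt_top), ← integral_const_mul]
  refine integral_congr_ae (Filter.Eventually.of_forall fun x => ?_)
  simp only [smul_eq_mul]
  rw [ENNReal.toReal_ofReal (by positivity), mul_assoc]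

lemma mgf_sq_norm_stdGaussian {s : ℝ} (hs : s < 1 / 2) :
    mgf (fun x : F => ‖x‖ ^ 2) (stdGaussian F) s = (1 - 2 * s) ^ (-(Module.finrank ℝ F / 2 : ℝ)) := by
  rw [mgf, integral_stdGaussian_eq]
  have h := GaussianFourier.integral_rexp_neg_mul_sq_norm (V := F) (b := 1 / 2 - s) (by linarith)
  have h2 : ∀ x : F, exp (-(1 / 2) * ‖x‖ ^ 2) * exp (s * ‖x‖ ^ 2)
      = exp (-(1 / 2 - s) * ‖x‖ ^ 2) := fun x => by
    rw [← exp_add]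
    congr 1
    ring
  simp_rw [h2]
  have h3 : π / (1 / 2 - s) = (2 * π) * (1 - 2 * s)⁻¹ := by
    have : (1 : ℝ) / 2 - s ≠ 0 := by linarith
    have : (1 : ℝ) - 2 * s ≠ 0 := by linarith
    field_simp
  have h4 : (0 : ℝ) < 1 - 2 * s := by linarith
  rw [h, h3, mul_rpow (x := 2 * π) (by positivity) (inv_nonneg.2 h4.le), ← mul_assoc, ← rpow_add (by positivity),
    inv_rpow h4.le, ← rpow_neg h4.le]
  simp

lemma integrable_exp_mul_sq_norm_stdGaussian {s : ℝ} (hs : s < 1 / 2) :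
    Integrable (fun x : F => exp (s * ‖x‖ ^ 2)) (stdGaussian F) := by
  rw [← mgf_pos_iff, mgf_sq_norm_stdGaussian hs]
  have : (0 : ℝ) < 1 - 2 * s := by linarith
  positivity

lemma integrable_exp_mul_norm_stdGaussian (s : ℝ) :
    Integrable (fun x : F => exp (s * ‖x‖)) (stdGaussian F) := by
  refine ((integrable_exp_mul_sq_norm_stdGaussian (F := F) (s := 1 / 4) (by norm_num)).const_mul
    (exp (s ^ 2))).mono' (by fun_prop) (Filter.Eventually.of_forall fun x => ?_)
  rw [norm_of_nonneg (exp_pos _).le, ← exp_add]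
  exact exp_le_exp.2 (by nlinarith [sq_nonneg (s - ‖x‖ / 2)])

/-- The logarithmic form of the Chernoff bound for `‖g‖`, at the threshold `√n (1 + u)`. -/
lemma exp_chernoff_sq_norm (n : ℝ) {u : ℝ} (hu : -1 < u) {s : ℝ}
    (hs : s = (1 - ((1 + u) ^ 2)⁻¹) / 2) :
    exp (-s * (n * (1 + u) ^ 2)) * (1 - 2 * s) ^ (-(n / 2))
      = exp (n / 2 * (2 * log (1 + u) - 2 * u - u ^ 2)) := by
  have h1 : 0 < 1 + u := by linarith
  have h2 : 1 - 2 * s = ((1 + u) ^ 2)⁻¹ := by rw [hs]; ring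
  rw [h2, inv_rpow (by positivity), ← rpow_neg (by positivity), neg_neg,
    rpow_def_of_pos (by positivity), ← exp_add, log_pow]
  congr 1
  have h3 : ((1 + u) ^ 2)⁻¹ * (1 + u) ^ 2 = 1 := inv_mul_cancel₀ (by positivity)
  rw [hs]
  push_cast
  linear_combination (n / 2) * h3

lemma stdGaussian_norm_ge_le {u : ℝ} (hu : 0 ≤ u) :
    (stdGaussian F).real {x | √(Module.finrank ℝ F) * (1 + u) ≤ ‖x‖}
      ≤ exp (Module.finrank ℝ F / 2 * (2 * log (1 + u) - 2 * u - u ^ 2)) := by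
  set n : ℝ := (Module.finrank ℝ F : ℝ)
  have hn : 0 ≤ n := Nat.cast_nonneg _
  -- The optimal Chernoff parameter, from 1 - 2s = (1+u)⁻².
  set s := (1 - ((1 + u) ^ 2)⁻¹) / 2 with hs
  have h1 : ((1 + u) ^ 2)⁻¹ ≤ 1 := inv_le_one_of_one_le₀ (by nlinarith)
  have h2 : 0 < ((1 + u) ^ 2)⁻¹ := by positivity
  have hsub : {x : F | √n * (1 + u) ≤ ‖x‖} ⊆ {x | n * (1 + u) ^ 2 ≤ ‖x‖ ^ 2} := by
    intro x hx
    have := pow_le_pow_left₀ (by positivity) (show √n * (1 + u) ≤ ‖x‖ from hx) 2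
    rwa [mul_pow, sq_sqrt hn] at this
  refine (measureReal_mono hsub).trans ?_
  refine (measure_ge_le_exp_mul_mgf _ (t := s) (by rw [hs]; linarith)
    (integrable_exp_mul_sq_norm_stdGaussian (by rw [hs]; linarith))).trans ?_
  rw [mgf_sq_norm_stdGaussian (by rw [hs]; linarith), exp_chernoff_sq_norm n (by linarith) hs]

lemma stdGaussian_norm_le_le {u : ℝ} (hu : u ≤ 0) (hu' : -1 < u) :
    (stdGaussian F).real {x | ‖x‖ ≤ √(Module.finrank ℝ F) * (1 + u)}
      ≤ exp (Module.finrank ℝ F / 2 * (2 * log (1 + u) - 2 * u - u ^ 2)) := by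
  set n : ℝ := (Module.finrank ℝ F : ℝ)
  have hn : 0 ≤ n := Nat.cast_nonneg _
  have hu0 : 0 < 1 + u := by linarith
  set s := (1 - ((1 + u) ^ 2)⁻¹) / 2 with hs
  have h1 : 1 ≤ ((1 + u) ^ 2)⁻¹ := (one_le_inv₀ (by positivity)).2 (by nlinarith)
  have hsub : {x : F | ‖x‖ ≤ √n * (1 + u)} ⊆ {x | ‖x‖ ^ 2 ≤ n * (1 + u) ^ 2} := by
    intro x hx
    have := pow_le_pow_left₀ (norm_nonneg x) (show ‖x‖ ≤ √n * (1 + u) from hx) 2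
    rwa [mul_pow, sq_sqrt hn] at this
  refine (measureReal_mono hsub).trans ?_
  refine (measure_le_le_exp_mul_mgf _ (t := s) (by rw [hs]; linarith)
    (integrable_exp_mul_sq_norm_stdGaussian (by rw [hs]; linarith))).trans ?_
  rw [mgf_sq_norm_stdGaussian (by rw [hs]; linarith), exp_chernoff_sq_norm n (by linarith) hs]

end StdGaussian

/-! ### Mean and tails of the Gaussian norm. -/

namespace ProxGD

open Real

/-- In polar coordinates the total mass and the mean norm are Gamma integrals with the same
prefactor, which cancels because the mass is 1. -/
lemma gaussNorm_eq_phi {n : ℕ} (hn : 0 < n) : gaussNorm n = phi n := by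
  have : NeZero n := ⟨hn.ne'⟩
  have hnt : Nontrivial (E n) := by
    have : Nonempty (Fin n) := ⟨0⟩
    infer_instance
  have hn0 : (0 : ℝ) < n := by exact_mod_cast hn
  have hpolar := fun h : ℝ → ℝ => integral_fun_norm_addHaar (volume : Measure (E n)) h
  set c : ℝ := (n : ℝ) * (volume : Measure (E n)).real (Metric.ball 0 1) with hc
  set C : ℝ := (2 * π) ^ (-(Module.finrank ℝ (E n) / 2 : ℝ)) with hC
  have hrad : ∀ q : ℝ, -1 < q → ∫ r in Set.Ioi (0 : ℝ), r ^ q * exp (-(1 / 2) * r ^ (2 : ℝ))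
      = 2 ^ ((q + 1) / 2) * (1 / 2) * Gamma ((q + 1) / 2) := by
    intro q hq
    rw [integral_rpow_mul_exp_neg_mul_rpow two_pos hq (by norm_num : (0 : ℝ) < 1 / 2)]
    congr 2
    rw [one_div, inv_rpow (by norm_num), ← rpow_neg (by norm_num)]
    congr 1
    ring
  have hone : 1 = C * (c * (2 ^ ((n : ℝ) / 2) * (1 / 2) * Gamma (n / 2))) := by
    have h := integral_stdGaussian_eq (F := E n) fun _ => 1
    rw [integral_const] at h
    simp only [probReal_univ, smul_eq_mul, mul_one] at h
    refine h.trans ?_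
    rw [hpolar fun r => exp (-(1 / 2) * r ^ 2)]
    have h2 := hrad (n - 1) (by linarith)
    rw [show (n : ℝ) - 1 + 1 = n by ring] at h2
    rw [← h2, ← hC, hc]
    simp only [finrank_euclideanSpace, Fintype.card_fin, nsmul_eq_mul, smul_eq_mul]
    rw [mul_assoc]
    congr 3
    refine setIntegral_congr_fun measurableSet_Ioi fun r hr => ?_
    rw [rpow_two, ← rpow_natCast, Nat.cast_sub hn, Nat.cast_one]
  have htwo : gaussNorm n
      = C * (c * (2 ^ (((n : ℝ) + 1) / 2) * (1 / 2) * Gamma ((n + 1) / 2))) := by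
    rw [gaussNorm, integral_stdGaussian_eq (F := E n),
      hpolar fun r => exp (-(1 / 2) * r ^ 2) * r]
    have h2 := hrad n (by linarith)
    rw [← h2, ← hC, hc]
    simp only [finrank_euclideanSpace, Fintype.card_fin, nsmul_eq_mul, smul_eq_mul]
    rw [mul_assoc]
    congr 3
    refine setIntegral_congr_fun measurableSet_Ioi fun r hr => ?_
    rw [rpow_two, rpow_natCast, mul_comm _ r, ← mul_assoc, ← pow_succ, Nat.sub_add_cancel hn]
  have hG : 0 < Gamma ((n : ℝ) / 2) := Gamma_pos_of_pos (by positivity)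
  have hpow : (2 : ℝ) ^ (((n : ℝ) + 1) / 2) = 2 ^ ((n : ℝ) / 2) * √2 := by
    rw [sqrt_eq_rpow, ← rpow_add two_pos]
    congr 1
    ring
  rw [htwo, hpow, phi, eq_div_iff hG.ne']
  linear_combination (-(√2 * Gamma (((n : ℝ) + 1) / 2))) * hone

lemma gaussNorm_pos {n : ℕ} (hn : 0 < n) : 0 < gaussNorm n := by
  rw [gaussNorm_eq_phi hn]
  exact phi_pos (by exact_mod_cast hn)

/-- Since b_n ≤ √n, the Chernoff bound centred at √n applies, and log(1+u) ≤ u already gives the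
Gaussian exponent. -/
lemma stdGaussian_norm_lt_gaussNorm_sub {n : ℕ} (hn : 0 < n) {t : ℝ} (ht : 0 ≤ t) :
    (stdGaussian (E n)).real {x | ‖x‖ < gaussNorm n - t} ≤ exp (-t ^ 2 / 2) := by
  have hn0 : (0 : ℝ) < n := by exact_mod_cast hn
  have hb : gaussNorm n ≤ √n := by
    rw [gaussNorm_eq_phi hn]
    exact phi_le_sqrt hn0
  have hs : 0 < √(n : ℝ) := sqrt_pos.2 hn0
  rcases le_or_gt (√n) t with h | h
  · have : {x : E n | ‖x‖ < gaussNorm n - t} = ∅ := by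
      ext x
      simp only [Set.mem_ofPred_eq, Set.mem_empty_iff_false, iff_false, not_lt]
      linarith [norm_nonneg x]
    rw [this]
    simp
    positivity
  · have hdiv : t / √n < 1 := (div_lt_one hs).2 h
    have h1 := stdGaussian_norm_le_le (F := E n) (u := -(t / √n)) (by
      have : 0 ≤ t / √n := by positivity
      linarith) (by linarith)
    simp only [finrank_euclideanSpace, Fintype.card_fin] at h1
    have hsub : {x : E n | ‖x‖ < gaussNorm n - t} ⊆ {x | ‖x‖ ≤ √n * (1 + -(t / √n))} := by
      intro x hx
      have hx : ‖x‖ < gaussNorm n - t := hx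
      have : √n * (1 + -(t / √n)) = √n - t := by field_simp; ring
      simp only [Set.mem_ofPred_eq, this]
      linarith
    refine (measureReal_mono hsub).trans (h1.trans (exp_le_exp.2 ?_))
    have h2 := log_le_sub_one_of_pos (show 0 < 1 + -(t / √n) by linarith)
    have h3 : (n : ℝ) * (t / √n) ^ 2 = t ^ 2 := by
      rw [div_pow, sq_sqrt hn0.le]; field_simp
    nlinarith

/-- Here replacing b_n by √n costs up to 1/(2√n). The bounds 3 ≤ t² and 7t ≤ b_n make this at most
t/42, and the Chernoff exponent has room for the loss. -/
lemma stdGaussian_gaussNorm_add_lt_norm {n : ℕ} (hn : 0 < n) {t : ℝ} (ht3 : 3 ≤ t ^ 2)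
    (ht0 : 0 ≤ t) (htb : 7 * t ≤ gaussNorm n) :
    (stdGaussian (E n)).real {x | gaussNorm n + t < ‖x‖} ≤ exp (-t ^ 2 / 2) := by
  have hn0 : (0 : ℝ) < n := by exact_mod_cast hn
  have hn1 : (1 : ℝ) ≤ n := by exact_mod_cast hn
  have hb : gaussNorm n ≤ √n := by
    rw [gaussNorm_eq_phi hn]
    exact phi_le_sqrt hn0
  have hb' : √n * (1 - 1 / (2 * n)) ≤ gaussNorm n := by
    rw [gaussNorm_eq_phi hn]
    exact sqrt_sub_le_phi hn1
  have hs : 0 < √(n : ℝ) := sqrt_pos.2 hn0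
  set τ := t / √n with hτ
  have hτ0 : 0 ≤ τ := by positivity
  have hτ7 : τ ≤ 1 / 7 := by rw [hτ, div_le_iff₀ hs]; linarith
  have hnτ : (n : ℝ) * τ ^ 2 = t ^ 2 := by
    rw [hτ, div_pow, sq_sqrt hn0.le]; field_simp
  -- From nτ² ≥ 3 and τ ≤ 1/7 follows nτ ≥ 21.
  have hinv : 1 / (2 * (n : ℝ)) ≤ τ / 42 := by
    rw [div_le_iff₀ (by positivity)]
    have := mul_le_mul_of_nonneg_left hτ7 (by positivity : 0 ≤ n * τ)
    nlinarith
  set u := 41 / 42 * τ with hu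
  have h1 := stdGaussian_norm_ge_le (F := E n) (u := u) (by positivity)
  simp only [finrank_euclideanSpace, Fintype.card_fin] at h1
  have hsub : {x : E n | gaussNorm n + t < ‖x‖} ⊆ {x | √n * (1 + u) ≤ ‖x‖} := by
    intro x hx
    have hx : gaussNorm n + t < ‖x‖ := hx
    have h2 : √n * τ = t := by rw [hτ]; field_simp
    have h3 : √n * (1 + u) ≤ gaussNorm n + t := by
      calc √n * (1 + u) = √n * (1 - τ / 42) + √n * τ := by rw [hu]; ring
        _ ≤ √n * (1 - 1 / (2 * n)) + t := by rw [h2]; gcongr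
        _ ≤ _ := by linarith
    exact h3.trans hx.le
  refine (measureReal_mono hsub).trans (h1.trans (exp_le_exp.2 ?_))
  have hu0 : 0 ≤ u := by positivity
  have hu7 : u ≤ 1 / 7 := by linarith
  have hlog : log (1 + u) ≤ u - u ^ 2 / 8 := by
    rw [log_le_iff_le_exp (by linarith)]
    have := quadratic_le_exp_of_nonneg (show 0 ≤ u - u ^ 2 / 8 by nlinarith)
    nlinarith [sq_nonneg u, mul_nonneg hu0 hu0, mul_nonneg (mul_nonneg hu0 hu0) hu0]
  have h5 : 2 * log (1 + u) - 2 * u - u ^ 2 ≤ -τ ^ 2 := by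
    have : τ ^ 2 ≤ 5 / 4 * u ^ 2 := by rw [hu]; nlinarith [sq_nonneg τ]
    linarith
  calc (n : ℝ) / 2 * (2 * log (1 + u) - 2 * u - u ^ 2) ≤ n / 2 * (-τ ^ 2) := by gcongr
    _ = -t ^ 2 / 2 := by rw [← hnτ]; ring

end ProxGD

/-! ### Concentration of convex Lipschitz functions by rotation. -/

section Concentration

open Real Filter Topology

variable {F : Type*} [NormedAddCommGroup F] [InnerProductSpace ℝ F] [FiniteDimensional ℝ F]
  [MeasurableSpace F] [BorelSpace F] {D : F → ℝ} {v : F → F}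

omit [FiniteDimensional ℝ F] [MeasurableSpace F] [BorelSpace F] in
lemma abs_sub_le_of_subgradient (hv1 : ∀ x, ‖v x‖ ≤ 1)
    (hv : ∀ x y, D x - D y ≤ inner ℝ (v x) (x - y)) (x y : F) : |D x - D y| ≤ ‖x - y‖ := by
  have key : ∀ x y, D x - D y ≤ ‖x - y‖ := fun x y => by
    refine (hv x y).trans ((real_inner_le_norm _ _).trans ?_)
    have := mul_le_mul_of_nonneg_right (hv1 x) (norm_nonneg (x - y))
    linarith
  rw [abs_le]
  have := key y x
  rw [norm_sub_rev] at this
  exact ⟨by linarith, key x y⟩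

omit [FiniteDimensional ℝ F] [MeasurableSpace F] [BorelSpace F] in
lemma continuous_of_subgradient (hv1 : ∀ x, ‖v x‖ ≤ 1)
    (hv : ∀ x y, D x - D y ≤ inner ℝ (v x) (x - y)) : Continuous D := by
  refine (LipschitzWith.of_dist_le_mul (K := 1) fun x y => ?_).continuous
  rw [dist_eq, dist_eq_norm, NNReal.coe_one, one_mul]
  exact abs_sub_le_of_subgradient hv1 hv x y

omit [FiniteDimensional ℝ F] [MeasurableSpace F] [BorelSpace F] in
lemma abs_le_of_subgradient (hv1 : ∀ x, ‖v x‖ ≤ 1)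
    (hv : ∀ x y, D x - D y ≤ inner ℝ (v x) (x - y)) (x : F) : |D x| ≤ |D 0| + ‖x‖ := by
  have h := abs_sub_le_of_subgradient hv1 hv x 0
  rw [sub_zero] at h
  calc |D x| = |D 0 + (D x - D 0)| := by ring_nf
    _ ≤ _ := (abs_add_le _ _).trans (by linarith)

lemma integrable_exp_mul_of_abs_le {f : F → ℝ} (hf : Measurable f) {c : ℝ}
    (hfc : ∀ x, |f x| ≤ c + ‖x‖) (s : ℝ) :
    Integrable (fun x => exp (s * f x)) (stdGaussian F) := by
  refine ((integrable_exp_mul_norm_stdGaussian (F := F) |s|).const_mul (exp (|s| * c))).mono'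
    (by fun_prop) (Eventually.of_forall fun x => ?_)
  rw [norm_of_nonneg (exp_pos _).le, ← exp_add]
  refine exp_le_exp.2 ?_
  calc s * f x ≤ |s| * |f x| := by rw [← abs_mul]; exact le_abs_self _
    _ ≤ |s| * (c + ‖x‖) := by gcongr; exact hfc x
    _ = _ := by ring

/-- One step of the discretized rotation argument. -/
lemma integral_exp_subgradient_le (hvm : Measurable v) (hv1 : ∀ x, ‖v x‖ ≤ 1)
    {a b : ℝ} (ha : 0 ≤ a) :
    Integrable (fun z : F × F => exp (a * inner ℝ (v z.1) z.1 + b * inner ℝ (v z.1) z.2))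
      ((stdGaussian F).prod (stdGaussian F)) ∧
    ∫ z : F × F, exp (a * inner ℝ (v z.1) z.1 + b * inner ℝ (v z.1) z.2)
      ∂((stdGaussian F).prod (stdGaussian F)) ≤
      mgf (fun x => ‖x‖) (stdGaussian F) a * exp (b ^ 2 / 2) := by
  have hin : ∀ x y : F, |inner ℝ (v x) y| ≤ ‖y‖ := fun x y =>
    (abs_real_inner_le_norm _ _).trans
      (by have := mul_le_mul_of_nonneg_right (hv1 x) (norm_nonneg y); linarith)
  have hint : Integrable (fun z : F × F => exp (a * inner ℝ (v z.1) z.1 + b * inner ℝ (v z.1) z.2))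
      ((stdGaussian F).prod (stdGaussian F)) := by
    refine ((integrable_exp_mul_norm_stdGaussian (F := F) a).mul_prod
      (integrable_exp_mul_norm_stdGaussian (F := F) |b|)).mono' (by fun_prop)
      (Eventually.of_forall fun z => ?_)
    rw [norm_of_nonneg (exp_pos _).le, ← exp_add]
    refine exp_le_exp.2 (add_le_add ?_ ?_)
    · exact mul_le_mul_of_nonneg_left ((le_abs_self _).trans (hin _ _)) ha
    · refine (le_abs_self _).trans ?_
      rw [abs_mul]
      exact mul_le_mul_of_nonneg_left (hin _ _) (abs_nonneg b)
  refine ⟨hint, ?_⟩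
  -- With the first coordinate frozen, the second enters through a centred Gaussian of variance at
  -- most 1.
  rw [integral_prod _ hint, mgf, ← integral_mul_const]
  refine integral_mono hint.integral_prod_left
    ((integrable_exp_mul_norm_stdGaussian a).mul_const _) fun x => ?_
  simp only [exp_add]
  rw [integral_const_mul]
  have h := mgf_inner_stdGaussian (v x) b
  rw [mgf] at h
  rw [h]
  refine mul_le_mul (exp_le_exp.2 ?_) (exp_le_exp.2 ?_) (exp_pos _).le (exp_pos _).le
  · exact mul_le_mul_of_nonneg_left ((le_abs_self _).trans (hin _ _)) ha
  · have : ‖v x‖ ^ 2 ≤ 1 := pow_le_one₀ (norm_nonneg _) (hv1 x)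
    nlinarith [sq_nonneg b]

omit [FiniteDimensional ℝ F] [MeasurableSpace F] [BorelSpace F] in
-- Telescope `D` along `N` points of the quarter circle from `z.1` to `z.2`. If (x, y) is the
-- rotated pair at the end of a step, that step has increment (1 - cos ε)x + (sin ε)y. The
-- subgradient at x bounds the change of `D`, and Jensen moves the exponential inside the average.
lemma exp_mul_sub_le_sum_rotation (hv : ∀ x y, D x - D y ≤ inner ℝ (v x) (x - y)) {s : ℝ}
    (hs : 0 ≤ s) {N : ℕ} (hN : 0 < N) {ε : ℝ} (hε : N * ε = π / 2) (z : F × F) :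
    exp (s * (D z.2 - D z.1)) ≤ ∑ k ∈ Finset.range N, (N : ℝ)⁻¹ *
      exp (s * N * (1 - cos ε) * inner ℝ (v (ContinuousLinearMap.rotation ((k + 1) * ε) z).1)
          (ContinuousLinearMap.rotation ((k + 1) * ε) z).1
        + s * N * sin ε * inner ℝ (v (ContinuousLinearMap.rotation ((k + 1) * ε) z).1)
          (ContinuousLinearMap.rotation ((k + 1) * ε) z).2) := by
  have hN0 : (0 : ℝ) < N := by exact_mod_cast hN
  set X : ℕ → F := fun k => cos (k * ε) • z.1 + sin (k * ε) • z.2 with hX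
  have h0 : X 0 = z.1 := by simp [hX]
  have hNX : X N = z.2 := by simp [hX, hε]
  have htel : D z.2 - D z.1 = ∑ k ∈ Finset.range N, (D (X (k + 1)) - D (X k)) := by
    rw [Finset.sum_range_sub fun k => D (X k), h0, hNX]
  have hstep : ∀ k : ℕ, D (X (k + 1)) - D (X k) ≤
      (1 - cos ε) * inner ℝ (v (ContinuousLinearMap.rotation ((k + 1) * ε) z).1)
          (ContinuousLinearMap.rotation ((k + 1) * ε) z).1
        + sin ε * inner ℝ (v (ContinuousLinearMap.rotation ((k + 1) * ε) z).1)
          (ContinuousLinearMap.rotation ((k + 1) * ε) z).2 := by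
    intro k
    have h1 : (ContinuousLinearMap.rotation ((k + 1) * ε) z).1 = X (k + 1) := by
      simp [hX, ContinuousLinearMap.rotation_apply]
    rw [h1, ← real_inner_smul_right, ← real_inner_smul_right, ← inner_add_right]
    refine (hv _ _).trans (le_of_eq ?_)
    congr 1
    have h2 : cos (k * ε) = cos ((k + 1) * ε) * cos ε + sin ((k + 1) * ε) * sin ε := by
      rw [← cos_sub]; ring_nf
    have h3 : sin (k * ε) = sin ((k + 1) * ε) * cos ε - cos ((k + 1) * ε) * sin ε := by
      rw [← sin_sub]; ring_nf
    simp only [hX, ContinuousLinearMap.rotation_apply, h2, h3]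
    push_cast
    module
  have hle : s * (D z.2 - D z.1) ≤ ∑ k ∈ Finset.range N, (N : ℝ)⁻¹ •
      (s * N * (1 - cos ε) * inner ℝ (v (ContinuousLinearMap.rotation ((k + 1) * ε) z).1)
          (ContinuousLinearMap.rotation ((k + 1) * ε) z).1
        + s * N * sin ε * inner ℝ (v (ContinuousLinearMap.rotation ((k + 1) * ε) z).1)
          (ContinuousLinearMap.rotation ((k + 1) * ε) z).2) := by
    rw [htel, Finset.mul_sum]
    refine Finset.sum_le_sum fun k _ => (mul_le_mul_of_nonneg_left (hstep k) hs).trans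
      (le_of_eq ?_)
    rw [smul_eq_mul]
    field_simp
  refine (exp_le_exp.2 hle).trans ?_
  have := convexOn_exp.map_sum_le (t := Finset.range N) (w := fun _ => (N : ℝ)⁻¹)
    (p := fun k => s * N * (1 - cos ε) *
        inner ℝ (v (ContinuousLinearMap.rotation ((k + 1) * ε) z).1)
          (ContinuousLinearMap.rotation ((k + 1) * ε) z).1
        + s * N * sin ε * inner ℝ (v (ContinuousLinearMap.rotation ((k + 1) * ε) z).1)
          (ContinuousLinearMap.rotation ((k + 1) * ε) z).2)
    (fun _ _ => by positivity) (by simp [hN0.ne']) (fun _ _ => Set.mem_univ _)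
  simpa only [smul_eq_mul] using this

/-- Rotations preserve the product Gaussian, so all summands have equal integral. As N → ∞ the
radial coefficient sN(1 - cos ε) vanishes, while the tangential one, sN sin ε, stays below sπ/2. -/
lemma integral_exp_mul_sub_le (hvm : Measurable v) (hv1 : ∀ x, ‖v x‖ ≤ 1)
    (hv : ∀ x y, D x - D y ≤ inner ℝ (v x) (x - y)) {s : ℝ} (hs : 0 ≤ s) :
    ∫ z : F × F, exp (s * (D z.2 - D z.1)) ∂((stdGaussian F).prod (stdGaussian F))
      ≤ exp (s ^ 2 * π ^ 2 / 8) := by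
  set γ := (stdGaussian F).prod (stdGaussian F) with hγ
  have hbound : ∀ N : ℕ, ∫ z : F × F, exp (s * (D z.2 - D z.1)) ∂γ
      ≤ mgf (fun x => ‖x‖) (stdGaussian F) (s * π ^ 2 / 8 * ((N : ℝ) + 1)⁻¹)
        * exp (s ^ 2 * π ^ 2 / 8) := by
    intro M
    set N := M + 1 with hN
    have hN0 : (0 : ℝ) < N := by positivity
    set ε : ℝ := π / 2 / N with hε
    have hNε : N * ε = π / 2 := by rw [hε]; field_simp
    have hε0 : 0 ≤ ε := by rw [hε]; positivity
    set H : F × F → ℝ := fun z => exp (s * N * (1 - cos ε) * inner ℝ (v z.1) z.1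
      + s * N * sin ε * inner ℝ (v z.1) z.2) with hH
    obtain ⟨hHint, hHle⟩ := integral_exp_subgradient_le hvm hv1 (a := s * N * (1 - cos ε))
      (b := s * N * sin ε) (mul_nonneg (by positivity) (by linarith [cos_le_one ε]))
    have hrot : ∀ θ : ℝ, MeasurePreserving (ContinuousLinearMap.rotation (E := F) θ) γ γ :=
      fun θ => ⟨by fun_prop, IsGaussian.map_rotation_eq_self integral_id_stdGaussian θ⟩
    have hrotint : ∀ θ : ℝ, Integrable (fun z => H (ContinuousLinearMap.rotation θ z)) γ :=
      fun θ => (hrot θ).integrable_comp_of_integrable hHint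
    have hroteq : ∀ θ : ℝ, ∫ z, H (ContinuousLinearMap.rotation θ z) ∂γ = ∫ z, H z ∂γ := by
      intro θ
      rw [← integral_map (φ := ContinuousLinearMap.rotation (E := F) θ) (by fun_prop)
        (by rw [(hrot θ).map_eq]; exact hHint.1), (hrot θ).map_eq]
    have h1 : ∫ z : F × F, exp (s * (D z.2 - D z.1)) ∂γ ≤ ∫ z, H z ∂γ := by
      calc ∫ z : F × F, exp (s * (D z.2 - D z.1)) ∂γ
          ≤ ∫ z, ∑ k ∈ Finset.range N, (N : ℝ)⁻¹ *
              H (ContinuousLinearMap.rotation ((k + 1) * ε) z) ∂γ := by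
            refine integral_mono_of_nonneg (Eventually.of_forall fun z => (exp_pos _).le)
              (integrable_finsetSum _ fun k _ => (hrotint _).const_mul _)
              (Eventually.of_forall fun z =>
                exp_mul_sub_le_sum_rotation hv hs M.succ_pos hNε z)
        _ = ∑ k ∈ Finset.range N, (N : ℝ)⁻¹ * ∫ z, H z ∂γ := by
            rw [integral_finsetSum _ fun k _ => (hrotint _).const_mul _]
            refine Finset.sum_congr rfl fun k _ => ?_
            rw [integral_const_mul, hroteq]
        _ = ∫ z, H z ∂γ := by
            rw [Finset.sum_const, Finset.card_range, nsmul_eq_mul, ← mul_assoc,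
              mul_inv_cancel₀ hN0.ne', one_mul]
    have hcos : s * N * (1 - cos ε) ≤ s * π ^ 2 / 8 * ((M : ℝ) + 1)⁻¹ := by
      have h2 := one_sub_sq_div_two_le_cos (x := ε)
      have h3 : s * π ^ 2 / 8 * ((M : ℝ) + 1)⁻¹ = s * N * (ε ^ 2 / 2) := by
        rw [hε, hN]; push_cast; field_simp; ring
      rw [h3]
      gcongr
      linarith
    have hsin : (s * N * sin ε) ^ 2 / 2 ≤ s ^ 2 * π ^ 2 / 8 := by
      have h2 : |sin ε| ≤ ε := by
        have := abs_sin_le_abs (x := ε)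
        rwa [abs_of_nonneg hε0] at this
      have h3 : sin ε ^ 2 ≤ ε ^ 2 := sq_le_sq' (by linarith [neg_abs_le (sin ε)])
        ((le_abs_self _).trans h2)
      calc (s * N * sin ε) ^ 2 / 2 = s ^ 2 * N ^ 2 / 2 * sin ε ^ 2 := by ring
        _ ≤ s ^ 2 * N ^ 2 / 2 * ε ^ 2 := by gcongr
        _ = s ^ 2 / 2 * (N * ε) ^ 2 := by ring
        _ = _ := by rw [hNε]; ring
    refine h1.trans (hHle.trans ?_)
    refine mul_le_mul ?_ (exp_le_exp.2 hsin) (exp_pos _).le mgf_nonneg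
    refine integral_mono (integrable_exp_mul_norm_stdGaussian _)
      (integrable_exp_mul_norm_stdGaussian _) fun x => ?_
    exact exp_le_exp.2 (mul_le_mul_of_nonneg_right hcos (norm_nonneg x))
  have hcont : Continuous (mgf (fun x : F => ‖x‖) (stdGaussian F)) :=
    continuous_mgf fun r => integrable_exp_mul_norm_stdGaussian r
  have hlim : Tendsto (fun N : ℕ => mgf (fun x : F => ‖x‖) (stdGaussian F)
      (s * π ^ 2 / 8 * ((N : ℝ) + 1)⁻¹) * exp (s ^ 2 * π ^ 2 / 8)) atTop
      (𝓝 (1 * exp (s ^ 2 * π ^ 2 / 8))) := by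
    refine Tendsto.mul_const _ ?_
    have h1 : Tendsto (fun N : ℕ => s * π ^ 2 / 8 * ((N : ℝ) + 1)⁻¹) atTop (𝓝 0) := by
      have := (tendsto_one_div_add_atTop_nhds_zero_nat (𝕜 := ℝ)).const_mul (s * π ^ 2 / 8)
      simpa only [one_div, mul_zero] using this
    have h2 := (hcont.tendsto 0).comp h1
    rw [mgf_zero] at h2
    exact h2
  rw [one_mul] at hlim
  exact ge_of_tendsto hlim (Eventually.of_forall hbound)

/-- Sub-Gaussian bound for the moment generating function of a convex `1`-Lipschitz function of a
standard Gaussian vector. -/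
lemma mgf_le_of_subgradient (hvm : Measurable v) (hv1 : ∀ x, ‖v x‖ ≤ 1)
    (hv : ∀ x y, D x - D y ≤ inner ℝ (v x) (x - y)) {s : ℝ} (hs : 0 ≤ s) :
    mgf D (stdGaussian F) s ≤ exp (s * ∫ x, D x ∂(stdGaussian F) + s ^ 2 * π ^ 2 / 8) := by
  have hDm := (continuous_of_subgradient hv1 hv).measurable
  have hDle := abs_le_of_subgradient hv1 hv
  have hint := fun r => integrable_exp_mul_of_abs_le hDm hDle r
  have hDint : Integrable D (stdGaussian F) := by
    refine (integrable_const |D 0|).add (IsGaussian.integrable_id (μ := stdGaussian F)).norm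
      |>.mono' (by fun_prop) (Eventually.of_forall fun x => hDle x)
  have h1 := integral_exp_mul_sub_le hvm hv1 hv hs
  have h2 : ∫ z : F × F, exp (s * (D z.2 - D z.1)) ∂((stdGaussian F).prod (stdGaussian F))
      = (∫ x, exp (-s * D x) ∂(stdGaussian F)) * mgf D (stdGaussian F) s := by
    rw [mgf, ← integral_prod_mul]
    refine integral_congr_ae (Eventually.of_forall fun z => ?_)
    simp only [← exp_add]
    congr 1
    ring
  -- Jensen replaces the independent copy by its mean.
  have h3 : exp (-s * ∫ x, D x ∂(stdGaussian F)) ≤ ∫ x, exp (-s * D x) ∂(stdGaussian F) := by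
    rw [← integral_const_mul]
    exact convexOn_exp.map_integral_le continuous_exp.continuousOn isClosed_univ
      (Eventually.of_forall fun _ => Set.mem_univ _) (hDint.const_mul _) (hint _)
  rw [h2] at h1
  have h4 := (mul_le_mul_of_nonneg_right h3 (mgf_nonneg (X := D) (μ := stdGaussian F)
    (t := s))).trans h1
  rw [exp_add]
  have h5 : exp (s * ∫ x, D x ∂(stdGaussian F)) * exp (-s * ∫ x, D x ∂(stdGaussian F)) = 1 := by
    rw [← exp_add]; simp
  calc mgf D (stdGaussian F) s = exp (s * ∫ x, D x ∂(stdGaussian F)) *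
        (exp (-s * ∫ x, D x ∂(stdGaussian F)) * mgf D (stdGaussian F) s) := by
        rw [← mul_assoc, h5, one_mul]
    _ ≤ _ := by gcongr

/-- A convex function has a smaller Gaussian mean after a contracted orthogonal projection. -/
lemma integral_smul_starProjection_le {L : F → ℝ} (hL : ConvexOn ℝ Set.univ L)
    (hint : Integrable L (stdGaussian F)) (K : Submodule ℝ F) {α : ℝ} (h0 : 0 ≤ α) (h1 : α ≤ 1)
    (hint' : Integrable (fun x => L (α • K.starProjection x)) (stdGaussian F)) :
    ∫ x, L (α • K.starProjection x) ∂(stdGaussian F) ≤ ∫ x, L x ∂(stdGaussian F) := by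
  have hpres : ∀ U : F ≃ₗᵢ[ℝ] F, MeasurePreserving U (stdGaussian F) (stdGaussian F) := fun U =>
    ⟨U.continuous.measurable, stdGaussian_map U⟩
  have hUi : ∀ U : F ≃ₗᵢ[ℝ] F, Integrable (fun x => L (U x)) (stdGaussian F) := fun U =>
    (hpres U).integrable_comp_of_integrable hint
  have hUe : ∀ U : F ≃ₗᵢ[ℝ] F, ∫ x, L (U x) ∂(stdGaussian F) = ∫ x, L x ∂(stdGaussian F) :=
    fun U => (hpres U).integral_comp U.toHomeomorph.measurableEmbedding L
  set U := K.reflection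
  set W := LinearIsometryEquiv.neg ℝ (E := F)
  -- With U = 2P_K - 1, the point αP_K x is the convex combination of x, Ux and -x with weights 1/2,
  -- α/2 and (1-α)/2; all three have the same Gaussian law.
  have hpt : ∀ x, L (α • K.starProjection x)
      ≤ 1 / 2 * L x + (α / 2 * L (U x) + (1 - α) / 2 * L (W x)) := by
    intro x
    have hx : α • K.starProjection x
        = (1 / 2 : ℝ) • x + (1 / 2 : ℝ) • (α • U x + (1 - α) • W x) := by
      have hU : U x = (2 : ℝ) • K.starProjection x - x := by
        rw [two_smul, ← two_nsmul]
        exact K.reflection_apply x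
      have hW : W x = -x := rfl
      rw [hU, hW]
      module
    have e1 := hL.2 (Set.mem_univ x) (Set.mem_univ (α • U x + (1 - α) • W x))
      (by norm_num : (0 : ℝ) ≤ 1 / 2) (by norm_num : (0 : ℝ) ≤ 1 / 2) (by norm_num)
    have e2 := hL.2 (Set.mem_univ (U x)) (Set.mem_univ (W x)) h0 (sub_nonneg.2 h1) (by ring)
    rw [hx]
    simp only [smul_eq_mul] at e1 e2
    linarith
  have hsum : Integrable (fun x => α / 2 * L (U x) + (1 - α) / 2 * L (W x)) (stdGaussian F) :=
    ((hUi U).const_mul _).add ((hUi W).const_mul _)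
  refine (integral_mono hint' ((hint.const_mul _).add hsum) hpt).trans (le_of_eq ?_)
  change ∫ x, (1 / 2 * L x + (α / 2 * L (U x) + (1 - α) / 2 * L (W x))) ∂(stdGaussian F) = _
  rw [integral_add (hint.const_mul _) hsum, integral_add ((hUi U).const_mul _)
    ((hUi W).const_mul _), integral_const_mul, integral_const_mul, integral_const_mul, hUe, hUe]
  ring

lemma integral_le_sqrt_integral_sq {f : F → ℝ} (hf : Measurable f) {c : ℝ}
    (hfc : ∀ x, |f x| ≤ c + ‖x‖) :
    ∫ x, f x ∂(stdGaussian F) ≤ √(∫ x, f x ^ 2 ∂(stdGaussian F)) := by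
  have hmem : MemLp f 2 (stdGaussian F) := by
    refine ((memLp_const c).add (IsGaussian.memLp_id (stdGaussian F) 2 (by simp)).norm).of_le
      hf.aestronglyMeasurable (Eventually.of_forall fun x => ?_)
    exact (hfc x).trans (le_abs_self _)
  have h := variance_nonneg f (stdGaussian F)
  rw [variance_eq_sub hmem] at h
  refine le_sqrt_of_sq_le ?_
  simpa using h

/-- The contracted projection is removed at the level of the moment generating function, as exp(sD)
is convex. The margin `2 * t` pays for the constant π²/8 of the rotation argument. -/
lemma stdGaussian_infDist_gt_le {S : Set F} (hS : Convex ℝ S) (hc : IsClosed S)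
    (hne : S.Nonempty) (K : Submodule ℝ F) {α : ℝ} (h0 : 0 ≤ α) (h1 : α ≤ 1) {t : ℝ}
    (ht : 0 ≤ t) :
    (stdGaussian F).real {x | √(∫ y, Metric.infDist y S ^ 2 ∂(stdGaussian F)) + 2 * t
      < Metric.infDist (α • K.starProjection x) S} ≤ exp (-t ^ 2 / 2) := by
  obtain ⟨v, hvm, hv1, hv⟩ := exists_measurable_subgradient_infDist hS hc hne
  set D : F → ℝ := fun x => Metric.infDist x S with hD
  set G := √(∫ y, D y ^ 2 ∂(stdGaussian F)) with hG
  have hDc : Continuous D := Metric.continuous_infDist_pt S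
  have hDle := abs_le_of_subgradient (D := D) hv1 hv
  have hDconv : ConvexOn ℝ Set.univ D := ⟨convex_univ, fun x _ y _ a b ha hb hab =>
    le_of_subgradient_convex_comb hv ha hb hab x y⟩
  have hmean : ∫ x, D x ∂(stdGaussian F) ≤ G := integral_le_sqrt_integral_sq hDc.measurable hDle
  have hcon : ∀ x, ‖α • K.starProjection x‖ ≤ ‖x‖ := fun x => by
    rw [norm_smul, norm_of_nonneg h0]
    have := K.norm_starProjection_apply_le x
    nlinarith [norm_nonneg (K.starProjection x)]
  have hcont' : Continuous fun x => D (α • K.starProjection x) := by fun_prop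
  have hDle' : ∀ x, |D (α • K.starProjection x)| ≤ |D 0| + ‖x‖ := fun x =>
    (hDle _).trans (by linarith [hcon x])
  -- Minimizes -2st + (10/8)s², where π² ≤ 10; the minimum is -(4/5)t².
  set s := 4 / 5 * t with hs
  have hs0 : 0 ≤ s := by positivity
  have hexp : ConvexOn ℝ Set.univ fun x => exp (s * D x) := by
    refine ⟨convex_univ, fun x _ y _ a b ha hb hab => ?_⟩
    have e1 := hDconv.2 (Set.mem_univ x) (Set.mem_univ y) ha hb hab
    have e2 := convexOn_exp.2 (Set.mem_univ (s * D x)) (Set.mem_univ (s * D y)) ha hb hab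
    refine le_trans (exp_le_exp.2 ?_) e2
    have := mul_le_mul_of_nonneg_left e1 hs0
    simp only [smul_eq_mul] at this ⊢
    linarith
  have hint := integrable_exp_mul_of_abs_le hcont'.measurable hDle' s
  have hmgf : mgf (fun x => D (α • K.starProjection x)) (stdGaussian F) s
      ≤ exp (s * G + s ^ 2 * π ^ 2 / 8) := by
    refine (integral_smul_starProjection_le hexp
      (integrable_exp_mul_of_abs_le hDc.measurable hDle s) K h0 h1 hint).trans ?_
    refine (mgf_le_of_subgradient hvm hv1 hv hs0).trans (exp_le_exp.2 ?_)
    gcongr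
  calc (stdGaussian F).real {x | G + 2 * t < D (α • K.starProjection x)}
      ≤ (stdGaussian F).real {x | G + 2 * t ≤ D (α • K.starProjection x)} :=
        measureReal_mono fun x hx =>
          show G + 2 * t ≤ D (α • K.starProjection x) from
            (show G + 2 * t < D (α • K.starProjection x) from hx).le
    _ ≤ exp (-s * (G + 2 * t)) * exp (s * G + s ^ 2 * π ^ 2 / 8) :=
        (measure_ge_le_exp_mul_mgf _ hs0 hint).trans (by gcongr)
    _ ≤ exp (-t ^ 2 / 2) := by
        rw [← exp_add]
        refine exp_le_exp.2 ?_
        have hpi : π ^ 2 ≤ 10 := by nlinarith [pi_lt_d2, pi_pos]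
        have : s ^ 2 * π ^ 2 ≤ s ^ 2 * 10 := by gcongr
        rw [hs] at this ⊢
        nlinarith [sq_nonneg t]

end Concentration

/-! ### Gaussian matrices and conditioning on their action on a subspace. -/

lemma measureReal_prod_le_of_forall {α β : Type*} [MeasurableSpace α] [MeasurableSpace β]
    {μ : Measure α} {ν : Measure β} [IsProbabilityMeasure μ] [IsProbabilityMeasure ν]
    {s : Set (α × β)} (hs : MeasurableSet s) {c : ℝ} (hc : 0 ≤ c)
    (h : ∀ a, ν.real (Prod.mk a ⁻¹' s) ≤ c) : (μ.prod ν).real s ≤ c := by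
  have h1 : (μ.prod ν) s ≤ ENNReal.ofReal c := by
    rw [Measure.prod_apply hs]
    calc ∫⁻ a, ν (Prod.mk a ⁻¹' s) ∂μ ≤ ∫⁻ _, ENNReal.ofReal c ∂μ := by
          refine lintegral_mono fun a => ?_
          rw [← ofReal_measureReal]
          exact ENNReal.ofReal_le_ofReal (h a)
      _ = ENNReal.ofReal c := by simp
  exact ENNReal.toReal_le_of_le_ofReal hc h1

namespace ProxGD

/-- `n × p` matrices with the Frobenius inner product, as families of rows. -/
abbrev RowSpace (n p : ℕ) : Type := PiLp 2 fun _ : Fin n => E p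

variable {n p : ℕ}

/-- The product `X u`. -/
noncomputable def matVec (x : RowSpace n p) (u : E p) : E n := WithLp.toLp 2 fun i => inner ℝ (x i) u

/-- The product `Xᵀ w`. -/
noncomputable def vecMat (x : RowSpace n p) (w : E n) : E p := ∑ i, w i • x i

/-- The rank one matrix `w uᵀ`. -/
noncomputable def outer (w : E n) (u : E p) : RowSpace n p := WithLp.toLp 2 fun i => w i • u

/-- Application of a linear map to every row. -/
noncomputable def mapRows (T : E p →L[ℝ] E p) (x : RowSpace n p) : RowSpace n p :=
  WithLp.toLp 2 fun i => T (x i)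

/-- The matrix whose rows are those of `x` projected to `K` plus those of `y` projected to the
orthogonal complement of `K`. -/
noncomputable def mixRows (K : Submodule ℝ (E p)) (x y : RowSpace n p) : RowSpace n p :=
  mapRows K.starProjection x + mapRows Kᗮ.starProjection y

/-- The matrix with given rows. -/
def toMat (x : RowSpace n p) : Matrix (Fin n) (Fin p) ℝ := Matrix.of fun i j => x i j

@[simp] lemma matVec_apply (x : RowSpace n p) (u : E p) (i : Fin n) :
    matVec x u i = inner ℝ (x i) u := rfl

@[simp] lemma outer_apply (w : E n) (u : E p) (i : Fin n) : outer w u i = w i • u := rfl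

@[simp] lemma mapRows_apply (T : E p →L[ℝ] E p) (x : RowSpace n p) (i : Fin n) :
    mapRows T x i = T (x i) := rfl

/-- The adjoint of `X ↦ X u` sends `w` to a rank one matrix of norm ‖w‖‖u‖. For unit `u` it is an
isometry, which identifies the law of `X u`; likewise for `Xᵀ w`. -/
lemma inner_matVec (x : RowSpace n p) (u : E p) (w : E n) :
    inner ℝ (matVec x u) w = inner ℝ x (outer w u) := by
  rw [PiLp.inner_apply, PiLp.inner_apply]
  refine Finset.sum_congr rfl fun i _ => ?_
  rw [outer_apply, real_inner_smul_right, matVec_apply, RCLike.inner_apply, conj_trivial]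

lemma inner_vecMat (x : RowSpace n p) (w : E n) (k : E p) :
    inner ℝ (vecMat x w) k = inner ℝ x (outer w k) := by
  rw [vecMat, sum_inner, PiLp.inner_apply x]
  refine Finset.sum_congr rfl fun i _ => ?_
  rw [outer_apply, real_inner_smul_right, real_inner_smul_left]

lemma inner_vecMat_eq (x : RowSpace n p) (w : E n) (k : E p) :
    inner ℝ k (vecMat x w) = inner ℝ (matVec x k) w := by
  rw [real_inner_comm, inner_vecMat, inner_matVec]

lemma norm_outer (w : E n) (u : E p) : ‖outer w u‖ = ‖w‖ * ‖u‖ := by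
  rw [← sq_eq_sq₀ (norm_nonneg _) (by positivity), PiLp.norm_sq_eq_of_L2, mul_pow,
    PiLp.norm_sq_eq_of_L2, Finset.sum_mul]
  simp [norm_smul, mul_pow]

@[fun_prop] lemma continuous_matVec :
    Continuous fun q : RowSpace n p × E p => matVec q.1 q.2 := by
  unfold matVec
  fun_prop

@[fun_prop] lemma continuous_vecMat :
    Continuous fun q : RowSpace n p × E n => vecMat q.1 q.2 := by
  unfold vecMat
  fun_prop

lemma continuous_mapRows (T : E p →L[ℝ] E p) :
    Continuous (mapRows T : RowSpace n p → RowSpace n p) := by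
  unfold mapRows
  fun_prop

lemma vecMat_smul (x : RowSpace n p) (c : ℝ) (w : E n) : vecMat x (c • w) = c • vecMat x w := by
  simp [vecMat, Finset.smul_sum, smul_smul]

lemma vecMat_sub (x : RowSpace n p) (w w' : E n) :
    vecMat x (w - w') = vecMat x w - vecMat x w' := by
  simp [vecMat, sub_smul]

lemma matVec_smul (x : RowSpace n p) (c : ℝ) (u : E p) : matVec x (c • u) = c • matVec x u := by
  ext i; simp [real_inner_smul_right]

lemma matVec_mixRows_of_mem {K : Submodule ℝ (E p)} (x y : RowSpace n p) {u : E p} (hu : u ∈ K) :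
    matVec (mixRows K x y) u = matVec x u := by
  ext i
  simp only [matVec_apply, mixRows, PiLp.add_apply, mapRows_apply, inner_add_left]
  rw [Submodule.inner_starProjection_left_eq_right, Submodule.inner_starProjection_left_eq_right,
    Submodule.starProjection_eq_self_iff.2 hu,
    Submodule.starProjection_apply_eq_zero_iff _ |>.2 (by simpa using hu), inner_zero_right,
    add_zero]

lemma matVec_mixRows_of_mem_orthogonal {K : Submodule ℝ (E p)} (x y : RowSpace n p) {u : E p}
    (hu : u ∈ Kᗮ) : matVec (mixRows K x y) u = matVec y u := by
  ext i
  simp only [matVec_apply, mixRows, PiLp.add_apply, mapRows_apply, inner_add_left]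
  rw [Submodule.inner_starProjection_left_eq_right, Submodule.inner_starProjection_left_eq_right,
    Submodule.starProjection_eq_self_iff.2 hu,
    Submodule.starProjection_apply_eq_zero_iff _ |>.2 hu, inner_zero_right, zero_add]

lemma starProjection_orthogonal_vecMat_mixRows (K : Submodule ℝ (E p)) (x y : RowSpace n p)
    (w : E n) : Kᗮ.starProjection (vecMat (mixRows K x y) w) = Kᗮ.starProjection (vecMat y w) := by
  simp only [vecMat, mixRows, map_sum, map_smul, PiLp.add_apply, mapRows_apply, map_add]
  refine Finset.sum_congr rfl fun i _ => ?_
  rw [Submodule.starProjection_apply_eq_zero_iff Kᗮ |>.2 (by simp), zero_add,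
    Submodule.starProjection_eq_self_iff.2 (Submodule.starProjection_apply_mem _ _)]

section Laws

lemma map_matVec_stdGaussian {u : E p} (hu : ‖u‖ = 1) :
    (stdGaussian (RowSpace n p)).map (fun x => matVec x u) = stdGaussian (E n) :=
  map_stdGaussian_of_adjoint (A' := fun w => outer w u) (by fun_prop)
    (fun x w => inner_matVec x u w) fun w => by rw [norm_outer, hu, mul_one]

lemma map_vecMat_stdGaussian {w : E n} (hw : ‖w‖ = 1) :
    (stdGaussian (RowSpace n p)).map (fun x => vecMat x w) = stdGaussian (E p) :=
  map_stdGaussian_of_adjoint (A' := fun k => outer w k) (by fun_prop)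
    (fun x k => inner_vecMat x w k) fun k => by rw [norm_outer, hw, one_mul]

/-- Replacing the part of the matrix on `Kᗮ` by an independent copy does not change its law. This
encodes the independence of the parts on `K` and `Kᗮ` without conditional distributions. -/
lemma map_mixRows_stdGaussian (K : Submodule ℝ (E p)) :
    ((stdGaussian (RowSpace n p)).prod (stdGaussian (RowSpace n p))).map
      (fun z => mixRows K z.1 z.2) = stdGaussian (RowSpace n p) := by
  have hadj : ∀ (L : Submodule ℝ (E p)) (x y : RowSpace n p),
      inner ℝ (mapRows L.starProjection x) y = inner ℝ x (mapRows L.starProjection y) := by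
    intro L x y
    simp [PiLp.inner_apply, Submodule.inner_starProjection_left_eq_right]
  refine map_prod_stdGaussian_of_adjoint (continuous_mapRows _).measurable
    (continuous_mapRows _).measurable (hadj K) (hadj Kᗮ) fun y => ?_
  rw [PiLp.norm_sq_eq_of_L2, PiLp.norm_sq_eq_of_L2, PiLp.norm_sq_eq_of_L2,
    ← Finset.sum_add_distrib]
  exact Finset.sum_congr rfl fun i _ => (K.norm_sq_eq_add_norm_sq_starProjection (y i)).symm

lemma measurable_mixRows (K : Submodule ℝ (E p)) :
    Measurable fun z : RowSpace n p × RowSpace n p => mixRows K z.1 z.2 :=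
  ((continuous_mapRows _).comp continuous_fst |>.add
    ((continuous_mapRows _).comp continuous_snd)).measurable

lemma measureReal_matVec_preimage {u : E p} (hu : ‖u‖ = 1) {s : Set (E n)}
    (hs : MeasurableSet s) :
    (stdGaussian (RowSpace n p)).real {x | matVec x u ∈ s} = (stdGaussian (E n)).real s := by
  rw [← map_matVec_stdGaussian (p := p) hu, map_measureReal_apply (by fun_prop) hs]
  rfl

/-- As `k` is orthogonal to `u`, the vector `X k` can be resampled with `X u` frozen, and its inner
product with a frozen vector is a scalar Gaussian. -/
lemma stdGaussian_inner_matVec_gt_le {u k : E p} (hk : ‖k‖ ≤ 1)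
    (hku : inner ℝ u k = 0) {W : E n → E n} (hW : Measurable W) {t : ℝ} (ht : 0 ≤ t) :
    (stdGaussian (RowSpace n p)).real
      {x | t * ‖W (matVec x u)‖ < |inner ℝ (matVec x k) (W (matVec x u))|}
      ≤ 2 * Real.exp (-t ^ 2 / 2) := by
  set K : Submodule ℝ (E p) := Submodule.span ℝ {u}
  have huK : u ∈ K := Submodule.mem_span_singleton_self u
  have hkK : k ∈ Kᗮ := Submodule.mem_orthogonal_singleton_iff_inner_right.2 hku
  have hmeas : MeasurableSet
      {x : RowSpace n p | t * ‖W (matVec x u)‖ < |inner ℝ (matVec x k) (W (matVec x u))|} :=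
    measurableSet_lt (by fun_prop) (by fun_prop)
  rw [← map_mixRows_stdGaussian K, map_measureReal_apply (measurable_mixRows K) hmeas]
  refine measureReal_prod_le_of_forall (measurable_mixRows K hmeas) (by positivity) fun a => ?_
  refine (measureReal_mono ?_).trans
    (stdGaussian_abs_inner_gt_le (outer (W (matVec a u)) k) ht)
  intro y hy
  simp only [Set.mem_preimage, Set.mem_ofPred_eq, matVec_mixRows_of_mem a y huK,
    matVec_mixRows_of_mem_orthogonal a y hkK] at hy ⊢
  rw [inner_matVec, real_inner_comm] at hy
  refine lt_of_le_of_lt ?_ hy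
  rw [norm_outer]
  exact mul_le_mul_of_nonneg_left (mul_le_of_le_one_right (norm_nonneg _) hk) ht

/-- `hvK` says that `v` sees only the part of the matrix on `K`. With that part frozen, the vector
is a projected Gaussian contracted by ‖v‖/V ≤ 1. -/
lemma stdGaussian_infDist_vecMat_gt_le (hn : 0 < n) {S : Set (E p)} (hS : Convex ℝ S)
    (hc : IsClosed S) (hne : S.Nonempty) (K : Submodule ℝ (E p)) {v : RowSpace n p → E n}
    (hv : Measurable v) (hvK : ∀ x y, v (mixRows K x y) = v x) {V : ℝ} (hV : 0 < V) {t : ℝ}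
    (ht : 0 ≤ t) :
    (stdGaussian (RowSpace n p)).real {x | ‖v x‖ ≤ V ∧
      √(∫ y, Metric.infDist y S ^ 2 ∂(stdGaussian (E p))) + 2 * t
        < Metric.infDist (V⁻¹ • Kᗮ.starProjection (vecMat x (v x))) S}
      ≤ Real.exp (-t ^ 2 / 2) := by
  set G := √(∫ y, Metric.infDist y S ^ 2 ∂(stdGaussian (E p)))
  have hmeas : MeasurableSet {x : RowSpace n p | ‖v x‖ ≤ V ∧
      G + 2 * t < Metric.infDist (V⁻¹ • Kᗮ.starProjection (vecMat x (v x))) S} :=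
    (measurableSet_le (f := fun x => ‖v x‖) (by fun_prop) (by fun_prop)).inter
      (measurableSet_lt (f := fun _ => G + 2 * t) (by fun_prop)
        ((Metric.continuous_infDist_pt S).measurable.comp
          (g := fun z => Metric.infDist z S)
          (f := fun x => V⁻¹ • Kᗮ.starProjection (vecMat x (v x))) (by fun_prop)))
  rw [← map_mixRows_stdGaussian K, map_measureReal_apply (measurable_mixRows K) hmeas]
  refine measureReal_prod_le_of_forall (measurable_mixRows K hmeas) (by positivity) fun a => ?_
  rcases le_or_gt ‖v a‖ V with ha | ha
  · obtain ⟨w, hw, hvw⟩ : ∃ w : E n, ‖w‖ = 1 ∧ v a = ‖v a‖ • w := by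
      rcases eq_or_ne (v a) 0 with h0 | h0
      · refine ⟨EuclideanSpace.single ⟨0, hn⟩ 1, by simp, by simp [h0]⟩
      · exact ⟨‖v a‖⁻¹ • v a, norm_smul_inv_norm h0, by
          rw [smul_smul, mul_inv_cancel₀ (norm_ne_zero_iff.2 h0), one_smul]⟩
    have hα1 : V⁻¹ * ‖v a‖ ≤ 1 := by rw [inv_mul_eq_div]; exact (div_le_one hV).2 ha
    have hbound := stdGaussian_infDist_gt_le hS hc hne Kᗮ
      (show 0 ≤ V⁻¹ * ‖v a‖ by positivity) hα1 ht
    have hms : MeasurableSet {y : E p | G + 2 * t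
        < Metric.infDist ((V⁻¹ * ‖v a‖) • Kᗮ.starProjection y) S} :=
      measurableSet_lt (by fun_prop) ((Metric.continuous_infDist_pt S).measurable.comp
        (by fun_prop))
    change (stdGaussian (E p)).real {y | G + 2 * t
        < Metric.infDist ((V⁻¹ * ‖v a‖) • Kᗮ.starProjection y) S} ≤ _ at hbound
    -- `G` is an integral against the same Gaussian; hiding its value confines the rewrite to the
    -- outer measure.
    clear_value G
    rw [← map_vecMat_stdGaussian (p := p) hw, map_measureReal_apply (by fun_prop) hms] at hbound
    refine (measureReal_mono ?_).trans hbound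
    intro y hy
    obtain ⟨-, hy⟩ := hy
    rw [hvK, starProjection_orthogonal_vecMat_mixRows, hvw, vecMat_smul, map_smul, smul_smul] at hy
    have hy' : G + 2 * t < Metric.infDist ((V⁻¹ * ‖v a‖) •
      Kᗮ.starProjection (vecMat y w)) S := hy
    exact hy'
  · have : Prod.mk a ⁻¹' ((fun z : RowSpace n p × RowSpace n p => mixRows K z.1 z.2) ⁻¹'
        {x | ‖v x‖ ≤ V ∧
          G + 2 * t < Metric.infDist (V⁻¹ • Kᗮ.starProjection (vecMat x (v x))) S}) = ∅ := by
      ext y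
      simp only [Set.mem_preimage, Set.mem_ofPred_eq, hvK, Set.mem_empty_iff_false, iff_false]
      exact fun h => absurd h.1 (not_le.2 ha)
    rw [this, measureReal_empty]
    positivity

end Laws

/-- Projections to a subspace of the plane spanned by `u` and `g` are controlled by two
coordinates. -/
lemma exists_norm_starProjection_le {u : E p} (hu : ‖u‖ = 1) (g : E p) :
    ∃ k : E p, ‖k‖ ≤ 1 ∧ inner ℝ u k = 0 ∧
      ∀ K : Submodule ℝ (E p), K ≤ Submodule.span ℝ {u, g} →
        ∀ y, ‖K.starProjection y‖ ≤ |inner ℝ u y| + |inner ℝ k y| := by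
  set g' := g - inner ℝ u g • u with hg'
  have huu : inner ℝ u u = (1 : ℝ) := by rw [real_inner_self_eq_norm_sq, hu, one_pow]
  have hug' : inner ℝ u g' = 0 := by
    rw [hg', inner_sub_right, real_inner_smul_right, huu, mul_one, sub_self]
  -- Gram–Schmidt; `k = 0` when `g` is a multiple of `u`.
  set k := ‖g'‖⁻¹ • g' with hk
  have huk : inner ℝ u k = 0 := by rw [hk, real_inner_smul_right, hug', mul_zero]
  have hgk : g' = ‖g'‖ • k := by
    rcases eq_or_ne g' 0 with h | h
    · simp [h]
    · rw [hk, smul_smul, mul_inv_cancel₀ (norm_ne_zero_iff.2 h), one_smul]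
  have hk01 : k = 0 ∨ ‖k‖ = 1 := by
    rcases eq_or_ne g' 0 with h | h
    · exact Or.inl (by simp [hk, h])
    · exact Or.inr (norm_smul_inv_norm h)
  refine ⟨k, ?_, huk, fun K hK y => ?_⟩
  · rcases hk01 with h | h
    · simp [h]
    · exact h.le
  obtain ⟨a, c, hac⟩ : ∃ a c : ℝ, K.starProjection y = a • u + c • k := by
    obtain ⟨a, c, h⟩ := Submodule.mem_span_pair.1 (hK (K.starProjection_apply_mem y))
    refine ⟨a + c * inner ℝ u g, c * ‖g'‖, ?_⟩
    rw [← h, mul_smul c, ← hgk, hg']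
    module
  set q := K.starProjection y with hq
  have hself : ‖q‖ ^ 2 = inner ℝ q y := by
    rw [← real_inner_self_eq_norm_sq, hq, Submodule.inner_starProjection_left_eq_right,
      Submodule.starProjection_eq_self_iff.2 (K.starProjection_apply_mem y), ← hq,
      hq, Submodule.inner_starProjection_left_eq_right]
  have ha : |a| ≤ ‖q‖ := by
    have h1 : inner ℝ u q = a := by
      rw [hac, inner_add_right, real_inner_smul_right, real_inner_smul_right, huu, huk]; ring
    rw [← h1]
    simpa [hu] using abs_real_inner_le_norm u q
  have hc : |c| * |inner ℝ k y| ≤ ‖q‖ * |inner ℝ k y| := by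
    rcases hk01 with h | h
    · simp [h]
    · refine mul_le_mul_of_nonneg_right ?_ (abs_nonneg _)
      have h1 : inner ℝ k q = c := by
        rw [hac, inner_add_right, real_inner_smul_right, real_inner_smul_right,
          real_inner_self_eq_norm_sq, h, real_inner_comm, huk]; ring
      rw [← h1]
      simpa [h] using abs_real_inner_le_norm k q
  have h2 : ‖q‖ ^ 2 ≤ ‖q‖ * (|inner ℝ u y| + |inner ℝ k y|) := by
    rw [hself]
    calc inner ℝ q y = a * inner ℝ u y + c * inner ℝ k y := by
          rw [hac, inner_add_left, real_inner_smul_left, real_inner_smul_left]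
      _ ≤ |a| * |inner ℝ u y| + |c| * |inner ℝ k y| := by
          rw [← abs_mul, ← abs_mul]
          exact add_le_add (le_abs_self _) (le_abs_self _)
      _ ≤ ‖q‖ * |inner ℝ u y| + ‖q‖ * |inner ℝ k y| :=
          add_le_add (mul_le_mul_of_nonneg_right ha (abs_nonneg _)) hc
      _ = _ := by ring
  rcases (norm_nonneg q).eq_or_lt with h | h
  · rw [← h]; positivity
  · rw [sq] at h2
    exact le_of_mul_le_mul_left h2 h

lemma gradStep_toMat (f : ℝ → ℝ) (α : ℝ) (x : RowSpace n p) (θs θ : E p) :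
    gradStep α (toMat x) (observe f (toMat x) θs) θ = θ + α • vecMat x
      (effNoise f (matVec x θs) - matVec x (θ - meanTerm f • θs)) := by
  have h1 : ∀ (u : E p) i, (toMat x *ᵥ u.ofLp) i = inner ℝ (x i) u := fun u i => by
    simp [toMat, Matrix.mulVec, dotProduct, PiLp.inner_apply, mul_comm]
  unfold gradStep
  congr 2
  ext j
  simp only [Matrix.mulVec, dotProduct, Matrix.transpose_apply, vecMat, PiLp.sub_apply,
    WithLp.ofLp_sum, Finset.sum_apply, smul_eq_mul, WithLp.ofLp_smul,
    Pi.smul_apply]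
  refine Finset.sum_congr rfl fun i _ => ?_
  have h2 := h1 θs i
  have h3 := h1 θ i
  simp only [Matrix.mulVec, dotProduct] at h2 h3
  simp only [Pi.sub_apply, observe, effNoise, matVec_apply, Matrix.mulVec, dotProduct, h2, h3,
    inner_sub_right, real_inner_smul_right]
  simp only [toMat, Matrix.of_apply]
  ring

@[fun_prop] lemma measurable_effNoise {f : ℝ → ℝ} (hf : Measurable f) :
    Measurable (effNoise f : E n → E n) := by
  unfold effNoise
  fun_prop

end ProxGD

/-! ### Contraction of the error in one step. -/

namespace ProxGD

variable {n p : ℕ}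

/-- Turns a distance bound into an actual subgradient. The slack `ε` avoids appealing to attainment;
`V = 0` is separate because the rescaling degenerates. -/
lemma exists_subgradient_norm_sub_le {R : E p → ℝ} (hR : ConvexOn ℝ Set.univ R) {xs q : E p}
    {lam V c ε : ℝ} (hV : 0 ≤ V) (hq : V = 0 → q = 0)
    (hdist : 0 < V → Metric.infDist (V⁻¹ • q) (lam • subdiff R xs) ≤ c) (hε : 0 < ε) :
    ∃ s ∈ subdiff R xs, ‖q - (V * lam) • s‖ ≤ V * c + ε := by
  obtain ⟨s₀, hs₀⟩ := subdiff_nonempty hR xs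
  rcases hV.eq_or_lt with h0 | h0
  · refine ⟨s₀, hs₀, ?_⟩
    rw [hq h0.symm, ← h0]
    simpa using hε.le
  · obtain ⟨y, ⟨s, hs, rfl⟩, hlt⟩ := (Metric.infDist_lt_iff ((Set.nonempty_of_mem hs₀).smul_set)).1
      (show Metric.infDist (V⁻¹ • q) (lam • subdiff R xs) < c + ε / V from
        lt_of_le_of_lt (hdist h0) (by have := div_pos hε h0; linarith))
    refine ⟨s, hs, ?_⟩
    have h1 : q - (V * lam) • s = V • (V⁻¹ • q - lam • s) := by
      rw [smul_sub, smul_smul, smul_smul, mul_inv_cancel₀ h0.ne', one_smul]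
    rw [dist_eq_norm] at hlt
    rw [h1, norm_smul, Real.norm_of_nonneg hV]
    calc V * ‖V⁻¹ • q - lam • s‖ ≤ V * (c + ε / V) := by gcongr
      _ = V * c + ε := by field_simp

set_option maxHeartbeats 1000000 in
/-- The error after one proximal gradient step, on the event where all the Gaussian quantities
are close to their typical values. -/
lemma norm_prox_gradStep_sub_le {R : E p → ℝ} (hR : ConvexOn ℝ Set.univ R) {f : ℝ → ℝ}
    {η t lam M G : ℝ} (hη : 0 ≤ η) (ht : 0 ≤ t) (hlam : 0 ≤ lam)
    (hb : 0 < gaussNorm n) (hGb : G + 7 * t ≤ gaussNorm n) {θs θ : E p}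
    (hM : ‖θ - meanTerm f • θs‖ ≤ M) {K : Submodule ℝ (E p)} {u e k : E p}
    (hu : ‖u‖ = 1) (hhu : θ - meanTerm f • θs = ‖θ - meanTerm f • θs‖ • u)
    (hhK : θ - meanTerm f • θs ∈ K)
    (he : ∀ y, ‖K.starProjection y‖ ≤ |inner ℝ θs y| + |inner ℝ e y|)
    (hk : ∀ y, ‖K.starProjection y‖ ≤ |inner ℝ u y| + |inner ℝ k y|)
    (huk : inner ℝ u k = 0) {x : RowSpace n p}
    (hnoise : ‖effNoise f (matVec x θs)‖ ≤ η * gaussNorm n * sigmaTerm f)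
    (hcorr : |inner ℝ (matVec x θs) (effNoise f (matVec x θs))|
      ≤ η * (gaussNorm n ^ 2 / √(n : ℝ)) * gammaTerm f)
    (hup : ‖matVec x u‖ ≤ gaussNorm n + t) (hlo : gaussNorm n - t ≤ ‖matVec x u‖)
    (hku : |inner ℝ (matVec x k) (matVec x u)| ≤ t * ‖matVec x u‖)
    (hew : |inner ℝ (matVec x e) (effNoise f (matVec x θs))|
      ≤ t * ‖effNoise f (matVec x θs)‖)
    (hdist : 0 < (gaussNorm n + t) * M + gaussNorm n * (η * sigmaTerm f) →
      ‖effNoise f (matVec x θs) - matVec x (θ - meanTerm f • θs)‖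
        ≤ (gaussNorm n + t) * M + gaussNorm n * (η * sigmaTerm f) →
      Metric.infDist (((gaussNorm n + t) * M + gaussNorm n * (η * sigmaTerm f))⁻¹ •
        Kᗮ.starProjection (vecMat x
          (effNoise f (matVec x θs) - matVec x (θ - meanTerm f • θs))))
        (lam • subdiff R (meanTerm f • θs)) ≤ G + 2 * t) :
    ‖prox R (shrinkage n f η t lam M) (gradStep (1 / gaussNorm n ^ 2) (toMat x)
        (observe f (toMat x) θs) θ) - meanTerm f • θs‖
      ≤ (G + 7 * t) / gaussNorm n * (M + η * sigmaTerm f) + η * gammaTerm f / √(n : ℝ) := by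
  rw [gradStep_toMat]
  set b := gaussNorm n
  set σ := sigmaTerm f
  have hσ : 0 ≤ σ := Real.sqrt_nonneg _
  set γ := gammaTerm f
  set xs := meanTerm f • θs
  set h := θ - xs with hh
  set w := effNoise f (matVec x θs)
  set v := w - matVec x h with hv
  set V := (b + t) * M + b * (η * σ) with hVdef
  set r := ‖h‖ with hr
  have hr0 : 0 ≤ r := norm_nonneg h
  have hM0 : 0 ≤ M := hr0.trans hM
  have hV0 : 0 ≤ V := by positivity
  have hXh : matVec x h = r • matVec x u := by rw [hhu, matVec_smul]
  have hvV : ‖v‖ ≤ V := by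
    calc ‖v‖ ≤ ‖w‖ + ‖matVec x h‖ := norm_sub_le _ _
      _ ≤ η * b * σ + M * (b + t) := by
          rw [hXh, norm_smul, Real.norm_of_nonneg hr0]
          gcongr
      _ = V := by rw [hVdef]; ring
  have hl : shrinkage n f η t lam M = V * lam / b ^ 2 := by
    change ((1 + t / b) * M + η * σ) * lam / b = _
    rw [hVdef]
    field_simp
  have hl0 : 0 ≤ shrinkage n f η t lam M := by rw [hl]; positivity
  have hv0 : V = 0 → Kᗮ.starProjection (vecMat x v) = 0 := fun hV => by
    have : v = 0 := norm_le_zero_iff.1 (hvV.trans hV.le)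
    rw [this]
    simp [vecMat]
  -- The basis of the plane starts at `u`, the direction of `h`: the `u`-coordinate measures how far
  -- ‖Xu‖² is from b², and the `k`-coordinate is the cross term ⟨Xk, Xu⟩.
  have T1 : ‖K.starProjection (h - (1 / b ^ 2) • vecMat x (matVec x h))‖
      ≤ M * (3 * t * b + 2 * t ^ 2) / b ^ 2 := by
    refine (hk _).trans ?_
    have huh : inner ℝ u h = r := by
      rw [hhu, real_inner_smul_right, real_inner_self_eq_norm_sq, hu]; ring
    have hkh : inner ℝ k h = 0 := by
      rw [hhu, real_inner_smul_right, real_inner_comm, huk, mul_zero]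
    have e1 : inner ℝ u (h - (1 / b ^ 2) • vecMat x (matVec x h))
        = r * (b ^ 2 - ‖matVec x u‖ ^ 2) / b ^ 2 := by
      rw [inner_sub_right, huh, real_inner_smul_right, inner_vecMat_eq, hXh,
        real_inner_smul_right, real_inner_self_eq_norm_sq]
      field_simp
    have e2 : inner ℝ k (h - (1 / b ^ 2) • vecMat x (matVec x h))
        = -(r * inner ℝ (matVec x k) (matVec x u)) / b ^ 2 := by
      rw [inner_sub_right, hkh, real_inner_smul_right, inner_vecMat_eq, hXh,
        real_inner_smul_right]
      field_simp
      ring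
    have e3 : |b ^ 2 - ‖matVec x u‖ ^ 2| ≤ 2 * t * b + t ^ 2 := by
      rw [abs_le]
      constructor
      · nlinarith [norm_nonneg (matVec x u)]
      · nlinarith [norm_nonneg (matVec x u)]
    have e4 : |inner ℝ (matVec x k) (matVec x u)| ≤ t * b + t ^ 2 := by
      refine hku.trans ?_
      have := mul_le_mul_of_nonneg_left hup ht
      linarith
    rw [e1, e2, abs_div, abs_div, abs_neg, abs_mul, abs_mul, abs_of_nonneg hr0,
      abs_of_nonneg (sq_nonneg b), ← add_div]
    gcongr
    calc r * |b ^ 2 - ‖matVec x u‖ ^ 2| + r * |inner ℝ (matVec x k) (matVec x u)|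
        ≤ r * (2 * t * b + t ^ 2) + r * (t * b + t ^ 2) := by gcongr
      _ = r * (3 * t * b + 2 * t ^ 2) := by ring
      _ ≤ M * (3 * t * b + 2 * t ^ 2) := by gcongr
  -- Here the basis starts at θ*, so that the first coordinate is the correlation controlled by γ.
  have T2 : ‖K.starProjection (vecMat x w)‖ ≤ η * (b ^ 2 / √(n : ℝ)) * γ + t * (η * b * σ) := by
    refine (he _).trans (add_le_add ?_ ?_)
    · rw [inner_vecMat_eq]
      exact hcorr
    · rw [inner_vecMat_eq]
      exact hew.trans (by gcongr)
  refine le_of_forall_pos_le_add fun ε hε => ?_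
  obtain ⟨s, hs, T3⟩ := exists_subgradient_norm_sub_le hR (q := Kᗮ.starProjection (vecMat x v))
    (lam := lam) (c := G + 2 * t) (ε := ε * b ^ 2) hV0 hv0 (fun hV => hdist hV hvV)
    (by positivity)
  refine (norm_prox_sub_le hR hl0 _ xs hs).trans ?_
  have hdecomp : θ + (1 / b ^ 2) • vecMat x v - xs - shrinkage n f η t lam M • s
      = K.starProjection (h - (1 / b ^ 2) • vecMat x (matVec x h))
        + (1 / b ^ 2) • K.starProjection (vecMat x w)
        + (1 / b ^ 2) • (Kᗮ.starProjection (vecMat x v) - (V * lam) • s) := by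
    have e1 : vecMat x v = K.starProjection (vecMat x v) + Kᗮ.starProjection (vecMat x v) :=
      (K.starProjection_add_starProjection_orthogonal (vecMat x v)).symm
    have e2 : K.starProjection (vecMat x v) = K.starProjection (vecMat x w)
        - K.starProjection (vecMat x (matVec x h)) := by rw [hv, vecMat_sub, map_sub]
    have e3 : K.starProjection h = h := Submodule.starProjection_eq_self_iff.2 hhK
    have e4 : θ = xs + h := by rw [hh]; abel
    rw [map_sub, map_smul, e3, hl]
    nth_rewrite 1 [e1]
    rw [e2, e4]
    module
  rw [hdecomp]
  have hb2 : 0 ≤ 1 / b ^ 2 := by positivity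
  have hsqrt : η * (b ^ 2 / √(n : ℝ)) * γ = b ^ 2 * (η * γ / √(n : ℝ)) := by ring
  rw [hsqrt] at T2
  set Q := η * γ / √(n : ℝ)
  calc _ ≤ M * (3 * t * b + 2 * t ^ 2) / b ^ 2 + 1 / b ^ 2 * (b ^ 2 * Q + t * (η * b * σ))
        + 1 / b ^ 2 * (V * (G + 2 * t) + ε * b ^ 2) := by
        refine (norm_add₃_le).trans ?_
        rw [norm_smul, norm_smul, Real.norm_of_nonneg hb2]
        gcongr
    _ = (M * (3 * t * b + 2 * t ^ 2) + t * (η * b * σ) + V * (G + 2 * t)) / b ^ 2 + Q + ε := by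
        field_simp
        ring
    -- The coefficient of `M` on the left is bG + 5tb + tG + 4t²; since G + 7t ≤ b, the term tG +
    -- 4t² is at most 2tb. The coefficient of ησ is only bG + 3tb.
    _ ≤ (b * (G + 7 * t) * (M + η * σ)) / b ^ 2 + Q + ε := by
        gcongr
        rw [hVdef]
        have h1 : 0 ≤ η * σ := by positivity
        have h2 : 0 ≤ M * t := by positivity
        have h3 : 0 ≤ M * t * (2 * b - 4 * t - G) := mul_nonneg h2 (by linarith)
        have h4 : 0 ≤ 4 * (t * b * (η * σ)) := by positivity
        nlinarith
    _ = (G + 7 * t) / b * (M + η * σ) + Q + ε := by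
        field_simp

/-- For small `t` the claimed failure probability exceeds 1, so the upper tail of the norm is needed
only for t² > 3. -/
lemma measureReal_le_seven_mul_exp {α : Type*} [MeasurableSpace α] {μ : Measure α}
    [IsProbabilityMeasure μ] {t : ℝ} (ht : t ^ 2 ≤ 3) (s : Set α) :
    μ.real s ≤ 7 * Real.exp (-t ^ 2 / 2) := by
  refine measureReal_le_one.trans ?_
  have h1 : Real.exp (-(3 / 2)) ≤ Real.exp (-t ^ 2 / 2) := Real.exp_le_exp.2 (by linarith)
  have h2 : 1 ≤ 7 * Real.exp (-(3 / 2)) := by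
    rw [Real.exp_neg, ← div_eq_mul_inv, one_le_div (Real.exp_pos _)]
    have h3 : Real.exp (3 / 2) ^ 2 = Real.exp 1 ^ 3 := by
      rw [← Real.exp_nat_mul, ← Real.exp_nat_mul]; norm_num
    have h4 : Real.exp 1 ^ 3 ≤ 3 ^ 3 :=
      pow_le_pow_left₀ (Real.exp_pos _).le Real.exp_one_lt_three.le 3
    nlinarith [Real.exp_pos (3 / 2)]
  linarith

lemma concProb_nonneg (n : ℕ) (f : ℝ → ℝ) (η : ℝ) : 0 ≤ concProb n f η :=
  add_nonneg measureReal_nonneg measureReal_nonneg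

/-- One step of the method contracts the error with high probability. -/
lemma stdGaussian_norm_prox_gradStep_sub_gt_le {R : E p → ℝ} (hR : ConvexOn ℝ Set.univ R)
    {f : ℝ → ℝ} (hf : Measurable f) {η t lam M : ℝ} (hη : 0 ≤ η) (ht : 0 ≤ t) (hlam : 0 ≤ lam)
    {θs θ : E p} (hθs : ‖θs‖ = 1) (hM : ‖θ - meanTerm f • θs‖ ≤ M)
    (hn : minSamples R (meanTerm f • θs) lam t < n) :
    (stdGaussian (RowSpace n p)).real
      {x | √(minSamples R (meanTerm f • θs) lam t / n) * M
          + η * (sigmaTerm f * √(minSamples R (meanTerm f • θs) lam t) + gammaTerm f) / √(n : ℝ)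
        < ‖prox R (shrinkage n f η t lam M) (gradStep (1 / gaussNorm n ^ 2) (toMat x)
          (observe f (toMat x) θs) θ) - meanTerm f • θs‖}
      ≤ concProb n f η + 7 * Real.exp (-t ^ 2 / 2) := by
  obtain ⟨hn₀, hphi⟩ := minSamples_spec R (meanTerm f • θs) lam ht
  set n₀ := minSamples R (meanTerm f • θs) lam t
  rcases le_or_gt (t ^ 2) 3 with ht3 | ht3
  · have := measureReal_le_seven_mul_exp (μ := stdGaussian (RowSpace n p)) ht3
      {x | √(n₀ / n) * M + η * (sigmaTerm f * √n₀ + gammaTerm f) / √(n : ℝ)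
        < ‖prox R (shrinkage n f η t lam M) (gradStep (1 / gaussNorm n ^ 2) (toMat x)
          (observe f (toMat x) θs) θ) - meanTerm f • θs‖}
    linarith [concProb_nonneg n f η]
  have hn0 : (0 : ℝ) < n := hn₀.trans hn
  have hnpos : 0 < n := by exact_mod_cast hn0
  have hb := gaussNorm_pos hnpos
  have hG : 0 ≤ gaussDist R (meanTerm f • θs) lam := Real.sqrt_nonneg _
  have hσ : 0 ≤ sigmaTerm f := Real.sqrt_nonneg _
  have hM0 : 0 ≤ M := (norm_nonneg _).trans hM
  have hratio := phi_le_mul_sqrt hn₀ hn.le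
  rw [← gaussNorm_eq_phi hnpos, hphi] at hratio
  have hsqrt1 : √(n₀ / n) ≤ 1 := Real.sqrt_le_one.2 ((div_le_one hn0).2 hn.le)
  have h2 : 0 ≤ √(2 : ℝ) := Real.sqrt_nonneg _
  set G := gaussDist R (meanTerm f • θs) lam with hGdef
  have hGb : G + 7 * t ≤ gaussNorm n := by
    have := mul_le_of_le_one_right hb.le hsqrt1
    linarith
  set h := θ - meanTerm f • θs with hh
  obtain ⟨u, hu, hhu⟩ : ∃ u : E p, ‖u‖ = 1 ∧ h = ‖h‖ • u := by
    rcases eq_or_ne h 0 with h0 | h0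
    · exact ⟨θs, hθs, by simp [h0]⟩
    · exact ⟨‖h‖⁻¹ • h, norm_smul_inv_norm h0, by
        rw [smul_smul, mul_inv_cancel₀ (norm_ne_zero_iff.2 h0), one_smul]⟩
  set K : Submodule ℝ (E p) := Submodule.span ℝ {θs, h} with hK
  have hθK : θs ∈ K := Submodule.subset_span (by simp)
  have hhK : h ∈ K := Submodule.subset_span (by simp)
  obtain ⟨e, he1, hθe, he⟩ := exists_norm_starProjection_le hθs h
  obtain ⟨k, hk1, huk, hk⟩ := exists_norm_starProjection_le hu θs
  have hKu : K ≤ Submodule.span ℝ {u, θs} := by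
    rw [hK, Submodule.span_le]
    rintro y (rfl | rfl)
    · exact Submodule.subset_span (by simp)
    · rw [hhu]
      exact Submodule.smul_mem _ _ (Submodule.subset_span (by simp))
  set V := (gaussNorm n + t) * M + gaussNorm n * (η * sigmaTerm f) with hV
  set v : RowSpace n p → E n := fun x => effNoise f (matVec x θs) - matVec x h with hv
  have hvm : Measurable v := by
    have := measurable_effNoise (n := n) hf
    fun_prop
  have hvK : ∀ x y, v (mixRows K x y) = v x := fun x y => by
    simp only [hv, matVec_mixRows_of_mem x y hθK, matVec_mixRows_of_mem x y hhK]
  set γ := stdGaussian (RowSpace n p)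
  -- The failure budget: `A1` and `A2` cost p(η), while `A3`, `A4` and `A7` cost one exponential
  -- each and the two-sided events `A5` and `A6` cost two each, seven in total.
  set A1 : Set (E n) := {g | η * gaussNorm n * sigmaTerm f < ‖effNoise f g‖} with hA1
  set A2 : Set (E n) :=
    {g | η * (gaussNorm n ^ 2 / √(n : ℝ)) * gammaTerm f < |inner ℝ g (effNoise f g)|} with hA2
  set A3 : Set (E n) := {g | gaussNorm n + t < ‖g‖} with hA3
  set A4 : Set (E n) := {g | ‖g‖ < gaussNorm n - t} with hA4
  set A5 : Set (RowSpace n p) :=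
    {x | t * ‖id (matVec x u)‖ < |inner ℝ (matVec x k) (id (matVec x u))|} with hA5
  set A6 : Set (RowSpace n p) := {x | t * ‖effNoise f (matVec x θs)‖
    < |inner ℝ (matVec x e) (effNoise f (matVec x θs))|} with hA6
  set A7 : Set (RowSpace n p) := {x | 0 < V ∧ ‖v x‖ ≤ V ∧ G + 2 * t < Metric.infDist
    (V⁻¹ • Kᗮ.starProjection (vecMat x (v x))) (lam • subdiff R (meanTerm f • θs))} with hA7
  have hen := measurable_effNoise (n := n) hf
  have P1 : γ.real {x | matVec x θs ∈ A1} = (stdGaussian (E n)).real A1 :=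
    measureReal_matVec_preimage hθs (measurableSet_lt (by fun_prop) (by fun_prop))
  have P2 : γ.real {x | matVec x θs ∈ A2} = (stdGaussian (E n)).real A2 :=
    measureReal_matVec_preimage hθs (measurableSet_lt (by fun_prop) (by fun_prop))
  have P3 : γ.real {x | matVec x u ∈ A3} ≤ Real.exp (-t ^ 2 / 2) :=
    (measureReal_matVec_preimage hu (measurableSet_lt (by fun_prop) (by fun_prop))).trans_le
      (stdGaussian_gaussNorm_add_lt_norm hnpos ht3.le ht (by linarith))
  have P4 : γ.real {x | matVec x u ∈ A4} ≤ Real.exp (-t ^ 2 / 2) :=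
    (measureReal_matVec_preimage hu (measurableSet_lt (by fun_prop) (by fun_prop))).trans_le
      (stdGaussian_norm_lt_gaussNorm_sub hnpos ht)
  have P5 : γ.real A5 ≤ 2 * Real.exp (-t ^ 2 / 2) :=
    stdGaussian_inner_matVec_gt_le hk1 huk measurable_id ht
  have P6 : γ.real A6 ≤ 2 * Real.exp (-t ^ 2 / 2) :=
    stdGaussian_inner_matVec_gt_le he1 hθe hen ht
  have P7 : γ.real A7 ≤ Real.exp (-t ^ 2 / 2) := by
    rcases le_or_gt V 0 with hV0 | hV0
    · have : A7 = ∅ := by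
        ext x
        simp only [hA7, Set.mem_ofPred_eq, Set.mem_empty_iff_false, iff_false]
        exact fun hx => absurd hx.1 (not_lt.2 hV0)
      rw [this, measureReal_empty]
      positivity
    · have := stdGaussian_infDist_vecMat_gt_le hnpos
        ((convex_subdiff R (meanTerm f • θs)).smul lam)
        (isClosed_smul_subdiff R (meanTerm f • θs) lam)
        ((subdiff_nonempty hR (meanTerm f • θs)).smul_set) K hvm hvK hV0 ht
      refine (measureReal_mono fun x hx => ?_).trans this
      exact hx.2
  have hsub : {x | √(n₀ / n) * M + η * (sigmaTerm f * √n₀ + gammaTerm f) / √(n : ℝ)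
        < ‖prox R (shrinkage n f η t lam M) (gradStep (1 / gaussNorm n ^ 2) (toMat x)
          (observe f (toMat x) θs) θ) - meanTerm f • θs‖}
      ⊆ {x | matVec x θs ∈ A1} ∪ {x | matVec x θs ∈ A2} ∪ {x | matVec x u ∈ A3}
        ∪ {x | matVec x u ∈ A4} ∪ A5 ∪ A6 ∪ A7 := by
    intro x hx
    by_contra hnot
    simp only [Set.mem_union, not_or] at hnot
    obtain ⟨⟨⟨⟨⟨⟨h1, h2⟩, h3⟩, h4⟩, h5⟩, h6⟩, h7⟩ := hnot
    have hstep := norm_prox_gradStep_sub_le hR hη ht hlam hb hGb hM hu hhu hhK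
      (he K le_rfl) (hk K hKu) huk (not_lt.1 h1) (not_lt.1 h2) (not_lt.1 h3) (not_lt.1 h4)
      (not_lt.1 h5) (not_lt.1 h6) (x := x) (fun hVp hvV => by
        by_contra! hlt
        exact h7 ⟨hVp, hvV, hlt⟩)
    have hx : √(n₀ / n) * M + η * (sigmaTerm f * √n₀ + gammaTerm f) / √(n : ℝ)
        < ‖prox R (shrinkage n f η t lam M) (gradStep (1 / gaussNorm n ^ 2) (toMat x)
          (observe f (toMat x) θs) θ) - meanTerm f • θs‖ := hx
    -- φ(n₀) = G + 7t + √2 is at most φ(n)√(n₀/n); the `√2` is dropped.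
    have h8 : (G + 7 * t) / gaussNorm n ≤ √(n₀ / n) := by
      rw [div_le_iff₀ hb]
      linarith
    have h9 : (G + 7 * t) / gaussNorm n * (M + η * sigmaTerm f)
        ≤ √(n₀ / n) * (M + η * sigmaTerm f) := by gcongr
    have h10 : √(n₀ / n) * (M + η * sigmaTerm f) + η * gammaTerm f / √(n : ℝ)
        = √(n₀ / n) * M + η * (sigmaTerm f * √n₀ + gammaTerm f) / √(n : ℝ) := by
      rw [Real.sqrt_div hn₀.le]
      ring
    linarith
  refine (measureReal_mono hsub).trans ?_
  have hU := fun (s s' : Set (RowSpace n p)) => measureReal_union_le (μ := γ) s s'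
  have hconc : concProb n f η = (stdGaussian (E n)).real A1 + (stdGaussian (E n)).real A2 := rfl
  rw [hconc, ← P1, ← P2]
  refine (hU _ _).trans ?_
  refine (add_le_add_left (hU _ _) _).trans ?_
  refine (add_le_add_left (add_le_add_left (hU _ _) _) _).trans ?_
  refine (add_le_add_left (add_le_add_left (add_le_add_left (hU _ _) _) _) _).trans ?_
  refine (add_le_add_left (add_le_add_left (add_le_add_left (add_le_add_left (hU _ _) _) _) _)
    _).trans ?_
  refine (add_le_add_left (add_le_add_left (add_le_add_left (add_le_add_left
    (add_le_add_left (hU _ _) _) _) _) _) _).trans ?_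
  linarith

end ProxGD

/-! ### Measurability of the iterates and independence of fresh batches. -/

namespace ProxGD

variable {n p : ℕ}

/-- The rows of the matrix with given entries. -/
def rowsOf (y : Fin n → Fin p → ℝ) : RowSpace n p :=
  WithLp.toLp 2 fun i => WithLp.toLp 2 fun j => y i j

@[fun_prop] lemma continuous_rowsOf : Continuous (rowsOf : (Fin n → Fin p → ℝ) → RowSpace n p) := by
  unfold rowsOf
  fun_prop

lemma map_rowsOf_pi_gaussianReal :
    (Measure.pi fun _ : Fin n × Fin p => gaussianReal 0 1).map
      (fun y => rowsOf fun i j => y (i, j)) = stdGaussian (RowSpace n p) := by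
  have h := map_stdGaussian_of_adjoint (F := EuclideanSpace ℝ (Fin n × Fin p))
    (K := RowSpace n p) (A := fun y => rowsOf fun i j => y (i, j))
    (A' := fun x => WithLp.toLp 2 fun q => x q.1 q.2) (by fun_prop)
    (fun y x => by
      simp only [PiLp.inner_apply, Fintype.sum_prod_type]
      rfl)
    (fun x => by
      rw [← sq_eq_sq₀ (norm_nonneg _) (norm_nonneg _), PiLp.norm_sq_eq_of_L2,
        PiLp.norm_sq_eq_of_L2, Fintype.sum_prod_type]
      refine Finset.sum_congr rfl fun i _ => ?_
      rw [PiLp.norm_sq_eq_of_L2])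
  rw [← map_pi_eq_stdGaussian, Measure.map_map (by fun_prop) (by fun_prop)] at h
  exact h

lemma iterate_congr (R : E p → ℝ) (f : ℝ → ℝ) (θs θ₀ : E p) (l : ℕ → ℝ)
    {X Y : ℕ → Matrix (Fin n) (Fin p) ℝ} {τ : ℕ} (h : ∀ k < τ, X k = Y k) :
    iterate R f θs θ₀ l X τ = iterate R f θs θ₀ l Y τ := by
  induction τ with
  | zero => rfl
  | succ τ ih =>
    simp only [iterate]
    rw [ih fun k hk => h k (hk.trans τ.lt_succ_self), h τ τ.lt_succ_self]

lemma measurable_prox_gradStep {R : E p → ℝ} (hR : ConvexOn ℝ Set.univ R) {f : ℝ → ℝ}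
    (hf : Measurable f) (θs : E p) {l : ℝ} (hl : 0 ≤ l) (α : ℝ) :
    Measurable fun q : E p × RowSpace n p =>
      prox R l (gradStep α (toMat q.2) (observe f (toMat q.2) θs) q.1) := by
  simp_rw [gradStep_toMat]
  have := measurable_effNoise (n := n) hf
  refine (lipschitzWith_prox hR hl).continuous.measurable.comp ?_
  fun_prop

lemma measurable_iterate {R : E p → ℝ} (hR : ConvexOn ℝ Set.univ R) {f : ℝ → ℝ}
    (hf : Measurable f) (θs θ₀ : E p) {l : ℕ → ℝ} (hl : ∀ k, 0 ≤ l k) {α : Type*}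
    [MeasurableSpace α] {Z : α → ℕ → Matrix (Fin n) (Fin p) ℝ}
    (hZ : ∀ k i j, Measurable fun a => Z a k i j) (τ : ℕ) :
    Measurable fun a => iterate R f θs θ₀ l (Z a) τ := by
  induction τ with
  | zero => exact measurable_const
  | succ τ ih =>
    have hrow : Measurable fun a => rowsOf (Z a τ) :=
      continuous_rowsOf.measurable.comp
        (measurable_pi_iff.2 fun i => measurable_pi_iff.2 fun j => hZ τ i j)
    have h := (measurable_prox_gradStep hR hf θs (hl τ) (1 / gaussNorm n ^ 2)).comp
      (ih.prodMk hrow)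
    simp only [Function.comp_def] at h
    simp only [iterate]
    exact h

section Resampling

variable {Ω : Type*} [MeasurableSpace Ω] {P : Measure Ω} [IsProbabilityMeasure P]
  {X : ℕ → Ω → Matrix (Fin n) (Fin p) ℝ}

lemma map_rowsOf_eq_stdGaussian
    (hXlaw : ∀ τ i j, HasLaw (fun ω => X τ ω i j) (gaussianReal 0 1) P)
    (hXindep : iIndepFun (fun (k : ℕ × Fin n × Fin p) ω => X k.1 ω k.2.1 k.2.2) P) (τ : ℕ) :
    P.map (fun ω => rowsOf (X τ ω)) = stdGaussian (RowSpace n p) := by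
  have hind : iIndepFun (fun (q : Fin n × Fin p) ω => X τ ω q.1 q.2) P :=
    hXindep.precomp (g := fun q : Fin n × Fin p => (τ, q)) (Prod.mk_right_injective τ)
  have hmeas : ∀ q : Fin n × Fin p, AEMeasurable (fun ω => X τ ω q.1 q.2) P :=
    fun q => (hXlaw τ q.1 q.2).aemeasurable
  have h := (iIndepFun_iff_map_fun_eq_pi_map hmeas).1 hind
  simp_rw [fun q : Fin n × Fin p => (hXlaw τ q.1 q.2).map_eq] at h
  have hrows : Measurable fun y : Fin n × Fin p → ℝ => rowsOf fun i j => y (i, j) :=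
    continuous_rowsOf.measurable.comp
      (measurable_pi_iff.2 fun i => measurable_pi_iff.2 fun j => measurable_pi_apply _)
  rw [← map_rowsOf_pi_gaussianReal, ← h, AEMeasurable.map_map_of_aemeasurable hrows.aemeasurable
    (aemeasurable_pi_lambda _ hmeas)]
  rfl

omit [IsProbabilityMeasure P] in
/-- The `τ`-th iterate is independent of the `τ`-th batch. -/
lemma indepFun_iterate_rowsOf {R : E p → ℝ} (hR : ConvexOn ℝ Set.univ R) {f : ℝ → ℝ}
    (hf : Measurable f) (θs θ₀ : E p) {l : ℕ → ℝ} (hl : ∀ k, 0 ≤ l k)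
    (hXlaw : ∀ τ i j, HasLaw (fun ω => X τ ω i j) (gaussianReal 0 1) P)
    (hXindep : iIndepFun (fun (k : ℕ × Fin n × Fin p) ω => X k.1 ω k.2.1 k.2.2) P) (τ : ℕ) :
    AEMeasurable (fun ω => iterate R f θs θ₀ l (fun k => X k ω) τ) P ∧
    AEMeasurable (fun ω => rowsOf (X τ ω)) P ∧
    IndepFun (fun ω => iterate R f θs θ₀ l (fun k => X k ω) τ) (fun ω => rowsOf (X τ ω)) P := by
  have hmeas : ∀ k : ℕ × Fin n × Fin p, AEMeasurable (fun ω => X k.1 ω k.2.1 k.2.2) P :=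
    fun k => (hXlaw k.1 k.2.1 k.2.2).aemeasurable
  set S : Finset (ℕ × Fin n × Fin p) := Finset.range τ ×ˢ Finset.univ with hS
  set T : Finset (ℕ × Fin n × Fin p) := {τ} ×ˢ Finset.univ with hT
  have hdisj : Disjoint S T := by
    rw [Finset.disjoint_left]
    rintro ⟨k, q⟩ hk hk'
    simp only [hS, hT, Finset.mem_product, Finset.mem_range, Finset.mem_singleton] at hk hk'
    exact absurd hk'.1 hk.1.ne
  have hind := hXindep.indepFun_finset₀ S T hdisj hmeas
  have hTmem : ∀ i j, ((τ, i, j) : ℕ × Fin n × Fin p) ∈ T := fun i j => by simp [hT]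
  have hSmem : ∀ k < τ, ∀ i j, ((k, i, j) : ℕ × Fin n × Fin p) ∈ S := fun k hk i j => by
    simp [hS, hk]
  -- Rebuilds the batches before `τ` from their finitely many entries; later batches get the default
  -- 0, which the `τ`-th iterate never reads.
  let Z : (S → ℝ) → ℕ → Matrix (Fin n) (Fin p) ℝ := fun y k i j =>
    if h : (k, i, j) ∈ S then y ⟨(k, i, j), h⟩ else 0
  have hZ : ∀ k i j, Measurable fun y => Z y k i j := fun k i j => by
    by_cases h : ((k, i, j) : ℕ × Fin n × Fin p) ∈ S
    · simp only [Z, h, dif_pos]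
      exact measurable_pi_apply _
    · simp only [Z, h, dif_neg, not_false_eq_true]
      exact measurable_const
  have hA : Measurable fun y => iterate R f θs θ₀ l (Z y) τ :=
    measurable_iterate hR hf θs θ₀ hl hZ τ
  have hB : Measurable fun y : T → ℝ => rowsOf fun i j => y ⟨(τ, i, j), hTmem i j⟩ :=
    continuous_rowsOf.measurable.comp
      (measurable_pi_iff.2 fun i => measurable_pi_iff.2 fun j => measurable_pi_apply _)
  have hAeq : (fun ω => iterate R f θs θ₀ l (fun k => X k ω) τ)
      = (fun y => iterate R f θs θ₀ l (Z y) τ) ∘ fun ω (i : S) => X i.1.1 ω i.1.2.1 i.1.2.2 := by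
    ext1 ω
    refine iterate_congr R f θs θ₀ l fun k hk => ?_
    ext i j
    simp only [Z, hSmem k hk i j, dif_pos]
  rw [hAeq]
  exact ⟨hA.comp_aemeasurable (aemeasurable_pi_lambda _ fun i => hmeas i.1),
    hB.comp_aemeasurable (f := fun ω (i : T) => X i.1.1 ω i.1.2.1 i.1.2.2)
      (aemeasurable_pi_lambda _ fun i => hmeas i.1),
    hind.comp hA hB⟩

end Resampling

end ProxGD

/-! ### Induction over the iterations. -/

theorem theorem3
    {Ω : Type*} [MeasurableSpace Ω] (P : Measure Ω) [IsProbabilityMeasure P]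
    (n p : ℕ)
    -- the link function, with finite nonlinearity parameters
    (f : ℝ → ℝ) (hf : Measurable f)
    (hf2 : MemLp f 2 (gaussianReal 0 1))
    (hgf2 : MemLp (fun g => g * f g) 2 (gaussianReal 0 1))
    -- the unknown parameter and the convex regularizer
    (θs : ProxGD.E p) (hθs : ‖θs‖ = 1)
    (R : ProxGD.E p → ℝ) (hR : ConvexOn ℝ Set.univ R)
    -- fresh mini-batches: all entries of all matrices are i.i.d. standard normal
    (X : ℕ → Ω → Matrix (Fin n) (Fin p) ℝ)
    (hXlaw : ∀ τ i j, HasLaw (fun ω => X τ ω i j) (gaussianReal 0 1) P)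
    (hXindep : iIndepFun (fun (k : ℕ × Fin n × Fin p) ω => X k.1 ω k.2.1 k.2.2) P)
    -- parameters
    (lam t η : ℝ) (hlam : 0 ≤ lam) (hη : 0 ≤ η)
    (ht0 : 0 ≤ t) (htb : t ≤ ProxGD.gaussNorm n)
    (n₀ : ℝ) (hn₀ : n₀ = ProxGD.minSamples R (ProxGD.meanTerm f • θs) lam t)
    (hn : n₀ < (n : ℝ))
    (θ₀ : ProxGD.E p) (M₀ ρ : ℝ)
    (hM₀ : ‖θ₀ - ProxGD.meanTerm f • θs‖ ≤ M₀)
    (hρ : √(n₀ / (n : ℝ)) ≤ ρ)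
    -- the bounds `M_τ` and the iterates run with the shrinkage parameters `λ_τ`
    (M : ℕ → ℝ) (hM : M = ProxGD.errBound n f η n₀ ρ M₀)
    (θ : ℕ → Ω → ProxGD.E p)
    (hθ : ∀ τ ω, θ τ ω = ProxGD.iterate R f θs θ₀
      (fun k => ProxGD.shrinkage n f η t lam (M k)) (fun k => X k ω) τ) :
    ∀ τ : ℕ,
      1 - (τ : ℝ) * (2 * ProxGD.concProb n f η + 7 * Real.exp (-t ^ 2 / 2)) ≤
        P.real {ω | ∀ k ≤ τ, ‖θ k ω - ProxGD.meanTerm f • θs‖ ≤ M k} := by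
  obtain ⟨hn₀pos, -⟩ := ProxGD.minSamples_spec R (ProxGD.meanTerm f • θs) lam ht0
  rw [← hn₀] at hn₀pos
  have hnpos : 0 < n := by exact_mod_cast hn₀pos.trans hn
  have hb := ProxGD.gaussNorm_pos hnpos
  have hσ : 0 ≤ ProxGD.sigmaTerm f := Real.sqrt_nonneg _
  have hγ : 0 ≤ ProxGD.gammaTerm f := Real.sqrt_nonneg _
  have hρ0 : 0 ≤ ρ := (Real.sqrt_nonneg _).trans hρ
  have hM0 : M 0 = M₀ := by rw [hM]; rfl
  have hMsucc : ∀ k, M (k + 1) = ρ * M k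
      + η * (ProxGD.sigmaTerm f * √n₀ + ProxGD.gammaTerm f) / √(n : ℝ) := fun k => by
    rw [hM]; rfl
  have hMnonneg : ∀ k, 0 ≤ M k := by
    intro k
    induction k with
    | zero => rw [hM0]; exact (norm_nonneg _).trans hM₀
    | succ k ih => rw [hMsucc]; positivity
  set l : ℕ → ℝ := fun k => ProxGD.shrinkage n f η t lam (M k) with hl
  have hl0 : ∀ k, 0 ≤ l k := fun k => by
    have := hMnonneg k
    simp only [hl, ProxGD.shrinkage]
    positivity
  set c := ProxGD.concProb n f η + 7 * Real.exp (-t ^ 2 / 2) with hc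
  have hc0 : 0 ≤ c := add_nonneg (ProxGD.concProb_nonneg n f η) (by positivity)
  have hθfun : ∀ τ, θ τ = fun ω => ProxGD.iterate R f θs θ₀ l (fun k => X k ω) τ :=
    fun τ => funext fun ω => hθ τ ω
  -- The event that the bound holds at `τ` and fails at `τ + 1`. By independence the joint law of
  -- iterate and batch is a product, so the one-step estimate applies to each frozen iterate.
  have hstep : ∀ τ, P.real {ω | ‖θ τ ω - ProxGD.meanTerm f • θs‖ ≤ M τ ∧
      M (τ + 1) < ‖θ (τ + 1) ω - ProxGD.meanTerm f • θs‖} ≤ c := by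
    intro τ
    obtain ⟨hθm, hXm, hind⟩ :=
      ProxGD.indepFun_iterate_rowsOf hR hf θs θ₀ hl0 hXlaw hXindep τ
    rw [← hθfun τ] at hθm hind
    set T : ProxGD.E p × ProxGD.RowSpace n p → ProxGD.E p := fun q =>
      ProxGD.prox R (l τ) (ProxGD.gradStep (1 / ProxGD.gaussNorm n ^ 2) (ProxGD.toMat q.2)
        (ProxGD.observe f (ProxGD.toMat q.2) θs) q.1) with hT
    have hTm : Measurable T := ProxGD.measurable_prox_gradStep hR hf θs (hl0 τ) _
    set s : Set (ProxGD.E p × ProxGD.RowSpace n p) :=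
      {q | ‖q.1 - ProxGD.meanTerm f • θs‖ ≤ M τ ∧
        M (τ + 1) < ‖T q - ProxGD.meanTerm f • θs‖} with hs
    have hsm : MeasurableSet s :=
      (measurableSet_le (f := fun q : ProxGD.E p × ProxGD.RowSpace n p =>
        ‖q.1 - ProxGD.meanTerm f • θs‖) (by fun_prop) measurable_const).inter
      (measurableSet_lt measurable_const
        (g := fun q => ‖T q - ProxGD.meanTerm f • θs‖) (by fun_prop))
    have hset : {ω | ‖θ τ ω - ProxGD.meanTerm f • θs‖ ≤ M τ ∧
        M (τ + 1) < ‖θ (τ + 1) ω - ProxGD.meanTerm f • θs‖}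
        = (fun ω => (θ τ ω, ProxGD.rowsOf (X τ ω))) ⁻¹' s := by
      ext ω
      have : θ (τ + 1) ω = T (θ τ ω, ProxGD.rowsOf (X τ ω)) := by
        rw [hθ, hθ]
        rfl
      simp only [Set.mem_preimage, hs, Set.mem_ofPred_eq, this]
    have := Measure.isProbabilityMeasure_map hθm
    rw [hset, measureReal_def, ← Measure.map_apply_of_aemeasurable (hθm.prodMk hXm) hsm,
      (indepFun_iff_map_prod_eq_prod_map_map hθm hXm).1 hind,
      ProxGD.map_rowsOf_eq_stdGaussian hXlaw hXindep, ← measureReal_def]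
    refine measureReal_prod_le_of_forall hsm hc0 fun a => ?_
    by_cases ha : ‖a - ProxGD.meanTerm f • θs‖ ≤ M τ
    · have hone := ProxGD.stdGaussian_norm_prox_gradStep_sub_gt_le hR hf hη ht0 hlam hθs ha
        (by rw [← hn₀]; exact hn)
      rw [← hn₀] at hone
      refine (measureReal_mono fun x hx => ?_).trans hone
      have hx2 : M (τ + 1) < ‖T (a, x) - ProxGD.meanTerm f • θs‖ := hx.2
      refine lt_of_le_of_lt ?_ hx2
      rw [hMsucc]
      have := mul_le_mul_of_nonneg_right hρ (hMnonneg τ)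
      linarith
    · have : Prod.mk a ⁻¹' s = ∅ := by
        ext x
        simp only [Set.mem_preimage, hs, Set.mem_ofPred_eq, Set.mem_empty_iff_false, iff_false]
        exact fun hx => ha hx.1
      rw [this, measureReal_empty]
      exact hc0
  intro τ
  induction τ with
  | zero =>
    have : {ω | ∀ k ≤ 0, ‖θ k ω - ProxGD.meanTerm f • θs‖ ≤ M k} = Set.univ := by
      ext ω
      simp only [Nat.le_zero, forall_eq, Set.mem_ofPred_eq, Set.mem_univ, iff_true]
      rw [hθ, hM0]
      exact hM₀
    rw [this]
    simp
  | succ τ ih =>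
    have hsub : {ω | ∀ k ≤ τ, ‖θ k ω - ProxGD.meanTerm f • θs‖ ≤ M k}
        ⊆ {ω | ∀ k ≤ τ + 1, ‖θ k ω - ProxGD.meanTerm f • θs‖ ≤ M k}
          ∪ {ω | ‖θ τ ω - ProxGD.meanTerm f • θs‖ ≤ M τ ∧
            M (τ + 1) < ‖θ (τ + 1) ω - ProxGD.meanTerm f • θs‖} := by
      intro ω hω
      have hω : ∀ k ≤ τ, ‖θ k ω - ProxGD.meanTerm f • θs‖ ≤ M k := hω
      rcases le_or_gt ‖θ (τ + 1) ω - ProxGD.meanTerm f • θs‖ (M (τ + 1)) with h | h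
      · refine Or.inl fun k hk => ?_
        rcases Nat.le_succ_iff.1 hk with hk | rfl
        · exact hω k hk
        · exact h
      · exact Or.inr ⟨hω τ le_rfl, h⟩
    have h1 := (measureReal_mono (μ := P) hsub).trans (measureReal_union_le _ _)
    have h2 := hstep τ
    -- A step costs p(η) only once; nonnegativity covers the second copy in the stated bound.
    have h3 := ProxGD.concProb_nonneg n f η
    push_cast
    linarith
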